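/- **Setting.** All algebras have the type $\langle \vee,\wedge,\to,{}',0,1\rangle$; write $x^*:=x\to 0$. A *dually quasi-De Morgan semi-Heyting algebra* ($\mathbf{DQD}$-algebra) is an algebra $\langle L,\vee,\wedge,\to,{}',0,1\rangle$ such that $\langle L,\vee,\wedge,0,1\rangle$ is a bounded lattice and, for all $x,y,z\in L$: $x\wedge(x\to y)=x\wedge y$; $x\wedge(y\to z)=x\wedge[(x\wedge y)\to(x\wedge z)]$; $x\to x=1$; $0'=1$ and $1'=0$; $(x\wedge y)'=x'\vee y'$; $(x\vee y)''=x''\vee y''$; $x''\le x$. $\mathbf{JIDL_1}$ is the variety of $\mathbf{DQD}$-algebras satisfying $x'\vee(y\to z)\approx(x'\vee y)\to(x'\vee z)$, $(x\to y)\vee(y\to x)\approx 1$, and the level $1$ identity $x\wedge x'^{*}\approx x\wedge x'^{*}\wedge x'^{*}{}'^{*}$. For a class $\mathbf K$ of algebras, $\mathbf{V}(\mathbf K)$ is the variety generated by $\mathbf K$, i.e. the smallest class containing $\mathbf K$ and closed under homomorphic images, subalgebras and direct products (the empty product included); the join $\vee$ of two varieties is the smallest variety containing both. A $\mathbf{DStH}$-chain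 is a $\mathbf{DQD}$-algebra that satisfies $(x\wedge y)\to y\approx 1$ and $x'\wedge x''\approx 0$ and whose lattice reduct is a chain. $\mathbf{DStHC}$ is the variety generated by all $\mathbf{DStH}$-chains. For $n\ge 1$, $\mathbf{C_n^{dp}}$ is the $n$-element $\mathbf{DStH}$-chain: the $n$-element chain with $x\to y=1$ if $x\le y$ and $x\to y=y$ otherwise, and with $1'=0$ and $x'=1$ for $x\ne 1$. $\mathbf{D_2}$ is the four-element Boolean Heyting algebra $\{0,a,b,1\}$ with $0'=1$, $1'=0$, $a'=a$, $b'=b$. $\mathcal L(\mathbf{JIDL_1})$ is the lattice of all subvarieties of $\mathbf{JIDL_1}$, ordered by inclusion. The height of an element of a lattice is the supremum of the lengths of the finite chains whose top element is that element. A variety is nontrivial if it has a member with at least two elements. $\mathbf 1\oplus\mathbf L$ is the lattice $\mathbf L$ with a new least element adjoined, $\omega+1$ is the chain $0<1<2<\cdots<\omega$, and $\mathbf 2$ is the two-element chain. **Corollary 7.1.** 1. $\mathcal L(\mathbf{JIDL_1})\cong \mathbf 1\oplus[(\omega+1)\times\mathbf 2]$. 2. $\mathbf{JIDL_1}$ and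 $\mathbf{DStHC}$ are the only two (distinct) elements of infinite height in $\mathcal L(\mathbf{JIDL_1})$. 3. The nontrivial subvarieties of $\mathbf{JIDL_1}$ of finite height are exactly $\mathbf V(\mathbf{D_2})$, the varieties $\mathbf V(\mathbf{C_n^{dp}})$ with $n\ge 2$, and the varieties $\mathbf V(\mathbf{C_m^{dp}})\vee\mathbf V(\mathbf{D_2})$ with $m\ge 2$. -/

import Mathlib

universe u

namespace SemiHeyting

/-- Operations of the similarity type `⟨∨, ∧, →, ', 0, 1⟩`, without any laws:
`⊔`, `⊓`, `⇨`, `￢`, `⊥`, `⊤`. In particular `￢x` stands for `x'`. -/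
class Ops (L : Type u) extends Max L, Min L, HImp L, HNot L, Bot L, Top L

/-- The derived operation `x* = x → 0`. -/
def star {L : Type u} [Ops L] (x : L) : L := x ⇨ ⊥

/-- The term function `x ↦ x'*`. -/
def primeStar {L : Type u} [Ops L] (x : L) : L := star (￢x)

/-- `t₀(x) = x` and `tₙ₊₁(x) = tₙ(x) ∧ x^{(n+1)('*)}`, where `x^{k('*)}` is the `k`-fold iterate
of `x ↦ x'*` at `x`. -/
def levelTerm {L : Type u} [Ops L] : ℕ → L → L
  | 0, x => x
  | n + 1, x => levelTerm n x ⊓ primeStar^[n + 1] x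

/-- Semi-Heyting algebras: bounded lattices with (SH1), (SH2), (SH3). -/
structure IsSemiHeyting (L : Type u) [Ops L] : Prop where
  sup_comm : ∀ x y : L, x ⊔ y = y ⊔ x
  sup_assoc : ∀ x y z : L, (x ⊔ y) ⊔ z = x ⊔ (y ⊔ z)
  inf_comm : ∀ x y : L, x ⊓ y = y ⊓ x
  inf_assoc : ∀ x y z : L, (x ⊓ y) ⊓ z = x ⊓ (y ⊓ z)
  sup_inf_self : ∀ x y : L, x ⊔ (x ⊓ y) = x
  inf_sup_self : ∀ x y : L, x ⊓ (x ⊔ y) = x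
  sup_bot : ∀ x : L, x ⊔ ⊥ = x
  inf_top : ∀ x : L, x ⊓ ⊤ = x
  sh1 : ∀ x y : L, x ⊓ (x ⇨ y) = x ⊓ y
  sh2 : ∀ x y z : L, x ⊓ (y ⇨ z) = x ⊓ ((x ⊓ y) ⇨ (x ⊓ z))
  sh3 : ∀ x : L, x ⇨ x = ⊤

/-- Dually quasi-De Morgan semi-Heyting algebras. The law `x'' ≤ x` is written as the identity
`x'' ∧ x = x''`. -/
structure IsDQD (L : Type u) [Ops L] : Prop extends IsSemiHeyting L where
  bot_prime : ￢(⊥ : L) = ⊤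
  top_prime : ￢(⊤ : L) = ⊥
  inf_prime : ∀ x y : L, ￢(x ⊓ y) = ￢x ⊔ ￢y
  sup_prime_prime : ∀ x y : L, ￢￢(x ⊔ y) = ￢￢x ⊔ ￢￢y
  prime_prime_le : ∀ x : L, ￢￢x ⊓ x = ￢￢x

/-- Dually Stone Heyting algebras (class `DStH`). -/
structure IsDStH (L : Type u) [Ops L] : Prop extends IsDQD L where
  heyting : ∀ x y : L, (x ⊓ y) ⇨ y = ⊤
  dualStone : ∀ x : L, ￢x ⊓ ￢￢x = ⊥

/-- The lattice reduct is a chain (`x ≤ y` means `x ∧ y = x`). -/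
def IsChainAlg (L : Type u) [Ops L] : Prop :=
  ∀ x y : L, x ⊓ y = x ∨ y ⊓ x = y

/-- JI-distributive, dually quasi-De Morgan, linear semi-Heyting algebras of level 1. -/
structure IsJIDL1 (L : Type u) [Ops L] : Prop extends IsDQD L where
  jid : ∀ x y z : L, ￢x ⊔ (y ⇨ z) = (￢x ⊔ y) ⇨ (￢x ⊔ z)
  linear : ∀ x y : L, (x ⇨ y) ⊔ (y ⇨ x) = ⊤
  level_one : ∀ x : L, levelTerm 1 x = levelTerm 2 x

/-- Algebras of the type `⟨∨, ∧, →, ', 0, 1⟩`. -/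
structure Alg : Type (u + 1) where
  carrier : Type u
  ops : Ops carrier

instance : CoeSort Alg.{u} (Type u) := ⟨Alg.carrier⟩

instance (A : Alg.{u}) : Ops A := A.ops

/-- Homomorphisms of algebras. -/
structure IsHom {L M : Type u} [Ops L] [Ops M] (f : L → M) : Prop where
  map_sup : ∀ x y : L, f (x ⊔ y) = f x ⊔ f y
  map_inf : ∀ x y : L, f (x ⊓ y) = f x ⊓ f y
  map_himp : ∀ x y : L, f (x ⇨ y) = f x ⇨ f y
  map_prime : ∀ x : L, f (￢x) = ￢(f x)
  map_bot : f ⊥ = ⊥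
  map_top : f ⊤ = ⊤

/-- Direct products, with componentwise operations. -/
def Alg.pi {ι : Type u} (A : ι → Alg.{u}) : Alg.{u} where
  carrier := ∀ i, A i
  ops :=
    { max := fun x y i => x i ⊔ y i
      min := fun x y i => x i ⊓ y i
      himp := fun x y i => x i ⇨ y i
      hnot := fun x i => ￢(x i)
      bot := fun _ => ⊥
      top := fun _ => ⊤ }

/-- A variety: a class of algebras closed under homomorphic images, (isomorphic copies of)
subalgebras and direct products. The empty product is allowed, so a variety is never empty. -/
@[ext]
structure Variety : Type (u + 1) where
  carrier : Set Alg.{u}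
  image_mem : ∀ (A B : Alg.{u}) (f : A → B), IsHom f → Function.Surjective f →
    A ∈ carrier → B ∈ carrier
  sub_mem : ∀ (A B : Alg.{u}) (f : A → B), IsHom f → Function.Injective f →
    B ∈ carrier → A ∈ carrier
  pi_mem : ∀ (ι : Type u) (A : ι → Alg.{u}), (∀ i, A i ∈ carrier) → Alg.pi A ∈ carrier

namespace Variety

/-- Varieties are ordered by inclusion. -/
instance : PartialOrder Variety.{u} :=
  PartialOrder.lift Variety.carrier fun _ _ h => Variety.ext h

instance : InfSet Variety.{u} where
  sInf S :=
    { carrier := {A | ∀ V ∈ S, A ∈ V.carrier}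
      image_mem := fun A B f hf hs hA V hV => V.image_mem A B f hf hs (hA V hV)
      sub_mem := fun A B f hf hi hB V hV => V.sub_mem A B f hf hi (hB V hV)
      pi_mem := fun ι A hA V hV => V.pi_mem ι A fun i => hA i V hV }

/-- The lattice of varieties: meets are intersections, and the join of two varieties is the
smallest variety that contains both. -/
instance : CompleteLattice Variety.{u} :=
  completeLatticeOfInf Variety.{u} fun _ =>
    ⟨fun _ hV _ hA => hA _ hV, fun _ hW _ hA V hV => hW hV hA⟩

/-- The variety generated by a class `K` of algebras: the smallest variety containing `K`. -/
def generate (K : Set Alg.{u}) : Variety.{u} :=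
  sInf {V | K ⊆ V.carrier}

/-- A variety is nontrivial if it has a member with at least two elements. -/
def IsNontrivial (V : Variety.{u}) : Prop :=
  ∃ A ∈ V.carrier, Nontrivial A

end Variety

theorem IsJIDL1.image {A B : Alg.{u}} {f : A → B} (hf : IsHom f)
    (hs : Function.Surjective f) (h : IsJIDL1 A) : IsJIDL1 B := by
  constructor
  · constructor
    · constructor
      · intro x y
        obtain ⟨x, rfl⟩ := hs x; obtain ⟨y, rfl⟩ := hs y
        simpa only [hf.map_sup] using congrArg f (h.sup_comm x y)
      · intro x y z
        obtain ⟨x, rfl⟩ := hs x; obtain ⟨y, rfl⟩ := hs y; obtain ⟨z, rfl⟩ := hs z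
        simpa only [hf.map_sup] using congrArg f (h.sup_assoc x y z)
      · intro x y
        obtain ⟨x, rfl⟩ := hs x; obtain ⟨y, rfl⟩ := hs y
        simpa only [hf.map_inf] using congrArg f (h.inf_comm x y)
      · intro x y z
        obtain ⟨x, rfl⟩ := hs x; obtain ⟨y, rfl⟩ := hs y; obtain ⟨z, rfl⟩ := hs z
        simpa only [hf.map_inf] using congrArg f (h.inf_assoc x y z)
      · intro x y
        obtain ⟨x, rfl⟩ := hs x; obtain ⟨y, rfl⟩ := hs y
        simpa only [hf.map_sup, hf.map_inf] using congrArg f (h.sup_inf_self x y)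
      · intro x y
        obtain ⟨x, rfl⟩ := hs x; obtain ⟨y, rfl⟩ := hs y
        simpa only [hf.map_sup, hf.map_inf] using congrArg f (h.inf_sup_self x y)
      · intro x
        obtain ⟨x, rfl⟩ := hs x
        simpa only [hf.map_sup, hf.map_bot] using congrArg f (h.sup_bot x)
      · intro x
        obtain ⟨x, rfl⟩ := hs x
        simpa only [hf.map_inf, hf.map_top] using congrArg f (h.inf_top x)
      · intro x y
        obtain ⟨x, rfl⟩ := hs x; obtain ⟨y, rfl⟩ := hs y
        simpa only [hf.map_himp, hf.map_inf] using congrArg f (h.sh1 x y)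
      · intro x y z
        obtain ⟨x, rfl⟩ := hs x; obtain ⟨y, rfl⟩ := hs y; obtain ⟨z, rfl⟩ := hs z
        simpa only [hf.map_himp, hf.map_inf] using congrArg f (h.sh2 x y z)
      · intro x
        obtain ⟨x, rfl⟩ := hs x
        simpa only [hf.map_himp, hf.map_top] using congrArg f (h.sh3 x)
    · simpa only [hf.map_prime, hf.map_bot, hf.map_top] using congrArg f h.bot_prime
    · simpa only [hf.map_prime, hf.map_bot, hf.map_top] using congrArg f h.top_prime
    · intro x y
      obtain ⟨x, rfl⟩ := hs x; obtain ⟨y, rfl⟩ := hs y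
      simpa only [hf.map_prime, hf.map_inf, hf.map_sup] using congrArg f (h.inf_prime x y)
    · intro x y
      obtain ⟨x, rfl⟩ := hs x; obtain ⟨y, rfl⟩ := hs y
      simpa only [hf.map_prime, hf.map_sup] using congrArg f (h.sup_prime_prime x y)
    · intro x
      obtain ⟨x, rfl⟩ := hs x
      simpa only [hf.map_prime, hf.map_inf] using congrArg f (h.prime_prime_le x)
  · intro x y z
    obtain ⟨x, rfl⟩ := hs x; obtain ⟨y, rfl⟩ := hs y; obtain ⟨z, rfl⟩ := hs z
    simpa only [hf.map_prime, hf.map_himp, hf.map_sup] using congrArg f (h.jid x y z)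
  · intro x y
    obtain ⟨x, rfl⟩ := hs x; obtain ⟨y, rfl⟩ := hs y
    simpa only [hf.map_himp, hf.map_sup, hf.map_top] using congrArg f (h.linear x y)
  · intro x
    obtain ⟨x, rfl⟩ := hs x
    simpa only [levelTerm, primeStar, star, Function.iterate_succ, Function.iterate_zero,
      Function.comp_apply, id_eq, hf.map_prime, hf.map_himp, hf.map_inf, hf.map_bot]
      using congrArg f (h.level_one x)

theorem IsJIDL1.sub {A B : Alg.{u}} {f : A → B} (hf : IsHom f)
    (hi : Function.Injective f) (h : IsJIDL1 B) : IsJIDL1 A := by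
  constructor
  · constructor
    · constructor
      · intro x y
        apply hi; simpa only [hf.map_sup] using h.sup_comm (f x) (f y)
      · intro x y z
        apply hi; simpa only [hf.map_sup] using h.sup_assoc (f x) (f y) (f z)
      · intro x y
        apply hi; simpa only [hf.map_inf] using h.inf_comm (f x) (f y)
      · intro x y z
        apply hi; simpa only [hf.map_inf] using h.inf_assoc (f x) (f y) (f z)
      · intro x y
        apply hi; simpa only [hf.map_sup, hf.map_inf] using h.sup_inf_self (f x) (f y)
      · intro x y
        apply hi; simpa only [hf.map_sup, hf.map_inf] using h.inf_sup_self (f x) (f y)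
      · intro x
        apply hi; simpa only [hf.map_sup, hf.map_bot] using h.sup_bot (f x)
      · intro x
        apply hi; simpa only [hf.map_inf, hf.map_top] using h.inf_top (f x)
      · intro x y
        apply hi; simpa only [hf.map_himp, hf.map_inf] using h.sh1 (f x) (f y)
      · intro x y z
        apply hi; simpa only [hf.map_himp, hf.map_inf] using h.sh2 (f x) (f y) (f z)
      · intro x
        apply hi; simpa only [hf.map_himp, hf.map_top] using h.sh3 (f x)
    · apply hi; simpa only [hf.map_prime, hf.map_bot, hf.map_top] using h.bot_prime
    · apply hi; simpa only [hf.map_prime, hf.map_bot, hf.map_top] using h.top_prime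
    · intro x y
      apply hi; simpa only [hf.map_prime, hf.map_inf, hf.map_sup] using h.inf_prime (f x) (f y)
    · intro x y
      apply hi; simpa only [hf.map_prime, hf.map_sup] using h.sup_prime_prime (f x) (f y)
    · intro x
      apply hi; simpa only [hf.map_prime, hf.map_inf] using h.prime_prime_le (f x)
  · intro x y z
    apply hi
    simpa only [hf.map_prime, hf.map_himp, hf.map_sup] using h.jid (f x) (f y) (f z)
  · intro x y
    apply hi
    simpa only [hf.map_himp, hf.map_sup, hf.map_top] using h.linear (f x) (f y)
  · intro x
    apply hi
    simpa only [levelTerm, primeStar, star, Function.iterate_succ, Function.iterate_zero,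
      Function.comp_apply, id_eq, hf.map_prime, hf.map_himp, hf.map_inf, hf.map_bot]
      using h.level_one (f x)

theorem IsJIDL1.pi {ι : Type u} {A : ι → Alg.{u}} (h : ∀ i, IsJIDL1 (A i)) :
    IsJIDL1 (Alg.pi A) where
  sup_comm x y := funext fun i => (h i).sup_comm (x i) (y i)
  sup_assoc x y z := funext fun i => (h i).sup_assoc (x i) (y i) (z i)
  inf_comm x y := funext fun i => (h i).inf_comm (x i) (y i)
  inf_assoc x y z := funext fun i => (h i).inf_assoc (x i) (y i) (z i)
  sup_inf_self x y := funext fun i => (h i).sup_inf_self (x i) (y i)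
  inf_sup_self x y := funext fun i => (h i).inf_sup_self (x i) (y i)
  sup_bot x := funext fun i => (h i).sup_bot (x i)
  inf_top x := funext fun i => (h i).inf_top (x i)
  sh1 x y := funext fun i => (h i).sh1 (x i) (y i)
  sh2 x y z := funext fun i => (h i).sh2 (x i) (y i) (z i)
  sh3 x := funext fun i => (h i).sh3 (x i)
  bot_prime := funext fun i => (h i).bot_prime
  top_prime := funext fun i => (h i).top_prime
  inf_prime x y := funext fun i => (h i).inf_prime (x i) (y i)
  sup_prime_prime x y := funext fun i => (h i).sup_prime_prime (x i) (y i)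
  prime_prime_le x := funext fun i => (h i).prime_prime_le (x i)
  jid x y z := funext fun i => (h i).jid (x i) (y i) (z i)
  linear x y := funext fun i => (h i).linear (x i) (y i)
  level_one x := funext fun i => (h i).level_one (x i)

/-- The variety `JIDL₁`. -/
def JIDL1 : Variety.{u} where
  carrier := {A | IsJIDL1 A}
  image_mem _ _ _ hf hs hA := IsJIDL1.image hf hs hA
  sub_mem _ _ _ hf hi hB := IsJIDL1.sub hf hi hB
  pi_mem _ _ hA := IsJIDL1.pi hA

/-- The variety `DStHC` generated by all dually Stone Heyting chains. -/
def DStHC : Variety.{u} :=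
  Variety.generate {A | IsDStH A ∧ IsChainAlg A}

/-- `Cₙᵈᵖ`, the dually Stone Heyting chain on the `n`-element chain `0 < 1 < ⋯ < n - 1`
(with `n ≥ 1`), in the universe `u`. -/
def Cdp (n : ℕ) [NeZero n] : Alg.{u} where
  carrier := ULift.{u} (Fin n)
  ops :=
    { max := fun x y => ⟨max x.down y.down⟩
      min := fun x y => ⟨min x.down y.down⟩
      himp := fun x y => if x.down ≤ y.down then ⟨(⊤ : Fin n)⟩ else y
      hnot := fun x => if x.down = (⊤ : Fin n) then ⟨0⟩ else ⟨(⊤ : Fin n)⟩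
      bot := ⟨0⟩
      top := ⟨(⊤ : Fin n)⟩ }

/-- `D₂`, the four-element Boolean Heyting algebra `{0, a, b, 1}`, realized as `Bool × Bool` with
`a = (1, 0)` and `b = (0, 1)`, expanded by `0' = 1`, `1' = 0`, `a' = a`, `b' = b`; that is,
`(p, q)' = (¬ q, ¬ p)`. -/
def D2 : Alg.{u} where
  carrier := ULift.{u} (Bool × Bool)
  ops :=
    { max := fun x y => ⟨x.down ⊔ y.down⟩
      min := fun x y => ⟨x.down ⊓ y.down⟩
      himp := fun x y => ⟨x.down ⇨ y.down⟩
      hnot := fun x => ⟨(!x.down.2, !x.down.1)⟩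
      bot := ⟨⊥⟩
      top := ⟨⊤⟩ }

end SemiHeyting

namespace SemiHeyting

/-! Linearity forces the implication to be Heyting implication, and the JI-distributive law then
gives `x' ∨ x'* = 1`, so every element of the form `x'` is complemented. Call a complemented `c`
with `c ≤ c'*` central; both `c` and its complement then generate normal filters. The level 1
identity gives `x ∧ x'* ≤ (x ∧ x'*)'*`, and this is enough to show that an algebra whose only
central elements are `0` and `1` is either a dually Stone Heyting chain or a copy of `D₂`
(`chain_or_four`).

Every member of `JIDL₁` is a subdirect product of such algebras: for each `e ≠ 1`, divide by a
normal filter maximal among those omitting `e`. The image of `e` lies in every nontrivial normal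
filter of the quotient, which leaves no room for a nontrivial central element (`exists_factor`). A
chain lies in every variety containing its finite subchains (`chain_mem`), so a subvariety is
determined by the finite chains in it and by whether it contains `D₂` (`le_of_generators`).

Smaller finite chains embed in larger ones, so the chains present form a cut in `ω + 1`, and `D₂`
contributes an independent bit. Independence is shown by explicit identities (`stratum`): ladder
identities bound the chains but always hold in `D₂` at the lengths used, while the dual Stone
identity holds in the chains and fails in `D₂`. The two-element chain embeds in every nontrivial
member, so the trivial variety lies below all the others. Heights are then computed in the resulting
order. -/

/-- The laws of `JIDL₁`, stated over a Heyting algebra with an extra unary operation. -/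
structure LevelOneLaws (L : Type u) [HeytingAlgebra L] [HNot L] : Prop where
  bot_prime : ￢(⊥ : L) = ⊤
  top_prime : ￢(⊤ : L) = ⊥
  inf_prime : ∀ x y : L, ￢(x ⊓ y) = ￢x ⊔ ￢y
  sup_prime_prime : ∀ x y : L, ￢￢(x ⊔ y) = ￢￢x ⊔ ￢￢y
  prime_prime_le : ∀ x : L, ￢￢x ≤ x
  prime_sup_compl : ∀ x : L, ￢x ⊔ (￢x)ᶜ = ⊤
  linear : ∀ x y : L, (x ⇨ y) ⊔ (y ⇨ x) = ⊤
  level_one : ∀ x : L, x ⊓ (￢x)ᶜ ≤ (￢(￢x)ᶜ)ᶜ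

/-! ### Indecomposable algebras: chains and the four-element case. -/

namespace LevelOneLaws

variable {L : Type u} [HeytingAlgebra L] [HNot L]

theorem prime_anti (h : LevelOneLaws L) {x y : L} (hxy : x ≤ y) : ￢y ≤ ￢x := by
  have := h.inf_prime x y
  rw [inf_eq_left.2 hxy] at this
  rw [this]; exact le_sup_right

theorem prime_prime_prime (h : LevelOneLaws L) (x : L) : ￢￢￢x = ￢x :=
  le_antisymm (h.prime_prime_le _) (h.prime_anti (h.prime_prime_le x))

theorem eq_top_of_prime_prime (h : LevelOneLaws L) {x : L} (hx : ￢￢x = ⊤) : x = ⊤ :=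
  top_le_iff.1 (hx ▸ h.prime_prime_le x)

theorem le_of_inf_compl_eq_bot {L : Type u} [HeytingAlgebra L] {x c : L} (hc : c ⊔ cᶜ = ⊤)
    (h : x ⊓ cᶜ = ⊥) : x ≤ c := by
  calc x = x ⊓ (c ⊔ cᶜ) := by rw [hc, inf_top_eq]
    _ = x ⊓ c := by rw [inf_sup_left, h, sup_bot_eq]
    _ ≤ c := inf_le_right

theorem compl_compl_of_sup {L : Type u} [HeytingAlgebra L] {c : L} (hc : c ⊔ cᶜ = ⊤) : cᶜᶜ = c :=
  le_antisymm (le_of_inf_compl_eq_bot hc (by rw [inf_comm, inf_compl_self])) le_compl_compl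

theorem eq_bot_of_compl_eq_top {L : Type u} [HeytingAlgebra L] {x : L} (h : xᶜ = ⊤) : x = ⊥ := by
  rw [← inf_compl_self x, h, inf_top_eq]

/-- On an element `c ≤ c'*`, the operation `'` is complementation. -/
theorem central (h : LevelOneLaws L) {c : L} (hle : c ≤ (￢c)ᶜ) :
    ￢c = cᶜ ∧ ￢cᶜ = c := by
  have h1 : ￢c ≤ cᶜ := le_compl_comm.1 hle
  have h2 : ￢c ⊔ ￢cᶜ = ⊤ := by rw [← h.inf_prime, inf_compl_self, h.bot_prime]
  have h3 : ￢cᶜ ≤ ￢￢c := h.prime_anti h1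
  have h4 : ￢cᶜ ≤ c := h3.trans (h.prime_prime_le c)
  have h5 : (￢c)ᶜ ≤ ￢cᶜ := by
    calc (￢c)ᶜ = (￢c)ᶜ ⊓ (￢c ⊔ ￢cᶜ) := by rw [h2, inf_top_eq]
      _ = (￢c)ᶜ ⊓ ￢cᶜ := by rw [inf_sup_left, compl_inf_self, bot_sup_eq]
      _ ≤ ￢cᶜ := inf_le_right
  have h6 : (￢c)ᶜ = c := le_antisymm (h5.trans h4) hle
  refine ⟨?_, le_antisymm h4 (hle.trans h5)⟩
  rw [← compl_compl_of_sup (h.prime_sup_compl c), h6]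

/-- There are no central elements besides `⊥` and `⊤`. -/
def Indecomposable (L : Type u) [HeytingAlgebra L] [HNot L] : Prop :=
  ∀ c : L, c ⊔ cᶜ = ⊤ → c ≤ (￢c)ᶜ → c = ⊥ ∨ c = ⊤

/-- For `c = x ∧ x'*`, level 1 says exactly that `c ≤ c'*`. The element `c` itself need not be
complemented, but `c'*` is, and it inherits the inequality, so indecomposability makes it `0` or
`1`. In the first case `c = 0`; in the second `c' = 0`, and `x' ≤ c'`. -/
theorem dichotomy (h : LevelOneLaws L) (hi : Indecomposable L) (x : L) :
    ￢x = ⊥ ∨ x ⊓ (￢x)ᶜ = ⊥ := by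
  set c := x ⊓ (￢x)ᶜ with hcdef
  have hτ : (￢c)ᶜ = (￢x)ᶜ ⊓ (￢(￢x)ᶜ)ᶜ := by rw [hcdef, h.inf_prime, compl_sup]
  have hc : c ≤ (￢c)ᶜ := by
    rw [hτ]; exact le_inf inf_le_right (h.level_one x)
  have hcompl : (￢c)ᶜ ⊔ (￢c)ᶜᶜ = ⊤ := by
    rw [compl_compl_of_sup (h.prime_sup_compl c), sup_comm, h.prime_sup_compl]
  rcases hi (￢c)ᶜ hcompl (compl_le_compl (h.prime_anti hc)) with h0 | h1
  · right; exact le_bot_iff.1 (h0 ▸ hc)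
  · left
    have : ￢c = ⊥ := eq_bot_of_compl_eq_top h1
    rw [hcdef, h.inf_prime, sup_eq_bot_iff] at this
    exact this.1

/-- The dichotomy gives `d ≤ d'` for every complemented `d ≠ 0, 1`. Applied to `c` this is one
inequality; applied to `c'`, which is again complemented, it gives `c' ≤ c'' ≤ c`. The law for `(x ∨
y)''` excludes `c' = 1`. -/
theorem prime_eq_self (h : LevelOneLaws L) (hi : Indecomposable L) {c : L} (hc : c ⊔ cᶜ = ⊤)
    (h0 : c ≠ ⊥) (h1 : c ≠ ⊤) : ￢c = c := by
  have key : ∀ d : L, d ⊔ dᶜ = ⊤ → d ≠ ⊥ → d ≠ ⊤ → d ≤ ￢d := by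
    intro d hd h0 h1
    rcases h.dichotomy hi d with h2 | h2
    · rcases hi d hd (by rw [h2, compl_bot]; exact le_top) with h3 | h3
      exacts [absurd h3 h0, absurd h3 h1]
    · exact le_of_inf_compl_eq_bot (h.prime_sup_compl d) h2
  have hle := key c hc h0 h1
  refine le_antisymm ?_ hle
  have hp0 : ￢c ≠ ⊥ := fun hb => h0 (le_bot_iff.1 (hb ▸ hle))
  have hp1 : ￢c ≠ ⊤ := by
    intro ht
    have h2 : ￢￢(c ⊔ cᶜ) = ￢￢c ⊔ ￢￢cᶜ := h.sup_prime_prime _ _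
    rw [hc, h.top_prime, h.bot_prime, ht, h.top_prime, bot_sup_eq] at h2
    exact h0 (eq_bot_of_compl_eq_top (h.eq_top_of_prime_prime h2.symm))
  exact (key _ (h.prime_sup_compl c) hp0 hp1).trans (h.prime_prime_le c)

/-- An indecomposable algebra is a chain with two-valued `'`, or has exactly four elements. -/
theorem chain_or_four (h : LevelOneLaws L) (hi : Indecomposable L) :
    ((∀ x y : L, x ≤ y ∨ y ≤ x) ∧ ∀ x : L, x = ⊤ ∨ ￢x = ⊤) ∨
    ∃ a : L, a ≠ ⊥ ∧ a ≠ ⊤ ∧ a ⊔ aᶜ = ⊤ ∧ ￢a = a ∧ ￢aᶜ = aᶜ ∧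
      ∀ x, x = ⊥ ∨ x = a ∨ x = aᶜ ∨ x = ⊤ := by
  by_cases hz : ∀ c : L, c ⊔ cᶜ = ⊤ → c = ⊥ ∨ c = ⊤
  · left
    have hv : ∀ x : L, ￢x = ⊥ ∨ ￢x = ⊤ := fun x => hz _ (h.prime_sup_compl x)
    constructor
    · intro x y
      -- Double prime turns linearity into a join of two elements, each `0` or `1`, that equals `1`.
      -- One of them is therefore `1`, and `z'' ≤ z` makes the corresponding implication `1`.
      have h1 := h.sup_prime_prime (x ⇨ y) (y ⇨ x)
      rw [h.linear, h.top_prime, h.bot_prime] at h1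
      rcases hv (￢(x ⇨ y)) with h2 | h2
      · rw [h2, bot_sup_eq] at h1
        exact Or.inr (himp_eq_top_iff.1 (h.eq_top_of_prime_prime h1.symm))
      · exact Or.inl (himp_eq_top_iff.1 (h.eq_top_of_prime_prime h2))
    · intro x
      rcases hv x with h1 | h1
      · left; apply h.eq_top_of_prime_prime; rw [h1, h.bot_prime]
      · exact Or.inr h1
  · right
    push Not at hz
    obtain ⟨a, ha, h0, h1⟩ := hz
    have hca : aᶜᶜ = a := compl_compl_of_sup ha
    have hb : aᶜ ⊔ aᶜᶜ = ⊤ := by rw [hca, sup_comm, ha]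
    have hb0 : aᶜ ≠ ⊥ := fun hh => h1 (by rw [← hca, hh, compl_bot])
    have hb1 : aᶜ ≠ ⊤ := fun hh => h0 (eq_bot_of_compl_eq_top hh)
    have hpa := h.prime_eq_self hi ha h0 h1
    have hpb := h.prime_eq_self hi hb hb0 hb1
    have split : ∀ x : L, x = (x ⊓ a) ⊔ (x ⊓ aᶜ) := fun x => by
      rw [← inf_sup_left, ha, inf_top_eq]
    -- the argument is symmetric in `c` and its complement
    have above : ∀ c : L, c ⊔ cᶜ = ⊤ → c ≠ ⊥ → c ≠ ⊤ → ￢c = c → ∀ x, ￢x = ⊥ → c ≤ x := by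
      intro c hc hc0 hc1 hpc x hx
      have h2 : ￢(x ⊓ c) = c := by rw [h.inf_prime, hx, hpc, bot_sup_eq]
      have h3 := h.prime_prime_le (x ⊓ c)
      rw [h2, hpc] at h3
      exact h3.trans inf_le_left
    have below : ∀ c : L, c ⊔ cᶜ = ⊤ → c ≠ ⊥ → c ≠ ⊤ → ￢c = c → ∀ x, ￢x = ⊤ → x ≤ c := by
      intro c hc hc0 hc1 hpc x hx
      -- Here `(x ∨ c)'' = x'' ∨ c'' = c`, and a further prime recovers `(x ∨ c)'`. The dichotomy
      -- then puts `x ∨ c` below `c`.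
      have h2 : ￢(x ⊔ c) = c := by
        have := h.sup_prime_prime x c
        rw [hx, h.top_prime, bot_sup_eq, hpc, hpc] at this
        rw [← h.prime_prime_prime, this, hpc]
      rcases h.dichotomy hi (x ⊔ c) with h3 | h3
      · exact absurd (h2.symm.trans h3) hc0
      · rw [h2] at h3
        exact le_sup_left.trans (le_of_inf_compl_eq_bot hc h3)
    have zero : ∀ x : L, ￢x = ⊤ → x = ⊥ := fun x hx =>
      le_bot_iff.1 ((le_inf (below a ha h0 h1 hpa x hx)
        (below aᶜ hb hb0 hb1 hpb x hx)).trans_eq (inf_compl_self a))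
    have one : ∀ x : L, ￢x = ⊥ → x = ⊤ := fun x hx =>
      top_le_iff.1 (ha.symm.le.trans (sup_le (above a ha h0 h1 hpa x hx)
        (above aᶜ hb hb0 hb1 hpb x hx)))
    -- The element `x'` is complemented and, by `zero` and `one`, proper, so it is a fixed point:
    -- `x' = x'' ≤ x`. The dichotomy gives the other inequality.
    have fixed : ∀ x : L, x ≠ ⊥ → x ≠ ⊤ → ￢x = x := by
      intro x hx0 hx1
      have hp0 : ￢x ≠ ⊥ := fun hh => hx1 (one x hh)
      have hp1 : ￢x ≠ ⊤ := fun hh => hx0 (zero x hh)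
      have h2 := h.prime_eq_self hi (h.prime_sup_compl x) hp0 hp1
      refine le_antisymm (h2 ▸ h.prime_prime_le x) ?_
      rcases h.dichotomy hi x with h3 | h3
      · exact absurd h3 hp0
      · exact le_of_inf_compl_eq_bot (h.prime_sup_compl x) h3
    refine ⟨a, h0, h1, ha, hpa, hpb, fun x => ?_⟩
    by_cases hx0 : x = ⊥
    · exact Or.inl hx0
    by_cases hx1 : x = ⊤
    · exact Or.inr (Or.inr (Or.inr hx1))
    -- comparable nontrivial elements coincide, since `'` fixes both and is antitone
    have eq_of_le : ∀ y : L, y ≠ ⊥ → y ≤ x → y = x := by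
      intro y hy0 hyx
      have hy1 : y ≠ ⊤ := fun hh => hx1 (top_le_iff.1 (hh ▸ hyx))
      have := h.prime_anti hyx
      rw [fixed x hx0 hx1, fixed y hy0 hy1] at this
      exact le_antisymm hyx this
    have hle : ∀ c : L, c ≠ ⊥ → c ≠ ⊤ → x ≤ c → x = c := by
      intro c hc0 hc1 hxc
      have := h.prime_anti hxc
      rw [fixed x hx0 hx1, fixed c hc0 hc1] at this
      exact le_antisymm hxc this
    by_cases hxa : x ⊓ a = ⊥
    · right; right; left
      have := split x
      rw [hxa, bot_sup_eq] at this
      exact hle _ hb0 hb1 (this ▸ inf_le_right)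
    · right; left
      exact hle _ h0 h1 (eq_of_le _ hxa inf_le_left ▸ inf_le_right)

/-! ### Normal filters. -/

/-- Filters closed under `x ↦ x'*`. -/
structure IsNormalFilter (F : Set L) : Prop where
  top_mem : ⊤ ∈ F
  mem_of_le : ∀ x y : L, x ≤ y → x ∈ F → y ∈ F
  inf_mem : ∀ x y : L, x ∈ F → y ∈ F → x ⊓ y ∈ F
  primeStar_mem : ∀ x : L, x ∈ F → (￢x)ᶜ ∈ F

theorem isNormalFilter_Ici (h : LevelOneLaws L) {c : L} (hc : c ≤ (￢c)ᶜ) :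
    IsNormalFilter (Set.Ici c) where
  top_mem := le_top
  mem_of_le _ _ h1 h2 := le_trans h2 h1
  inf_mem _ _ h1 h2 := le_inf h1 h2
  primeStar_mem _ hx := hc.trans (compl_le_compl (h.prime_anti hx))

theorem isNormalFilter_singleton_top (h : LevelOneLaws L) : IsNormalFilter ({⊤} : Set L) := by
  have := h.isNormalFilter_Ici (c := ⊤) (by rw [h.top_prime, compl_bot])
  rwa [Set.Ici_top] at this

/-- If the nontrivial normal filters have a common element besides `⊤`, then the algebra is
indecomposable. -/
theorem indecomposable_of_monolith (h : LevelOneLaws L) {e : L} (he : e ≠ ⊤)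
    (hm : ∀ F : Set L, IsNormalFilter F → e ∉ F → F ⊆ {⊤}) : Indecomposable L := by
  intro c hc hle
  obtain ⟨h1, h2⟩ := h.central hle
  -- The filters above `c` and above its complement are both normal. Since `c ∨ c* = 1`, they cannot
  -- both contain `e`, and one omitting `e` must be `{1}`.
  by_cases hec : c ≤ e
  · by_cases hec' : cᶜ ≤ e
    · exact absurd (top_le_iff.1 (hc.symm.le.trans (sup_le hec hec'))) he
    · left
      have := hm _ (h.isNormalFilter_Ici (c := cᶜ) (by rw [h2])) hec' (Set.mem_Ici.2 le_rfl)
      exact eq_bot_of_compl_eq_top this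
  · exact Or.inr (hm _ (h.isNormalFilter_Ici hle) hec (Set.mem_Ici.2 le_rfl))

/-- Zorn's lemma: the union of a chain of normal filters omitting `e` is again one. Maximality is
only among filters omitting `e`, which is what gives the quotient a smallest obstruction. -/
theorem exists_maximal_normalFilter (h : LevelOneLaws L) {e : L} (he : e ≠ ⊤) :
    ∃ F : Set L, IsNormalFilter F ∧ e ∉ F ∧
      ∀ G, IsNormalFilter G → e ∉ G → F ⊆ G → G ⊆ F := by
  suffices H : ∀ C ⊆ {F : Set L | IsNormalFilter F ∧ e ∉ F}, IsChain (· ⊆ ·) C → C.Nonempty →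
      ∃ ub ∈ {F : Set L | IsNormalFilter F ∧ e ∉ F}, ∀ s ∈ C, s ⊆ ub by
    obtain ⟨F, -, hF⟩ := zorn_subset_nonempty _ H {⊤} ⟨h.isNormalFilter_singleton_top, he⟩
    exact ⟨F, hF.prop.1, hF.prop.2, fun G h1 h2 h3 => hF.le_of_ge ⟨h1, h2⟩ h3⟩
  · rintro C hC hch ⟨F₀, hF₀⟩
    refine ⟨⋃₀ C, ⟨⟨⟨F₀, hF₀, (hC hF₀).1.top_mem⟩, ?_, ?_, ?_⟩, ?_⟩,
      fun s hs => Set.subset_sUnion_of_mem hs⟩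
    · rintro x y hxy ⟨F, hF, hx⟩
      exact ⟨F, hF, (hC hF).1.mem_of_le _ _ hxy hx⟩
    · rintro x y ⟨F, hF, hx⟩ ⟨G, hG, hy⟩
      rcases hch.total hF hG with hs | hs
      · exact ⟨G, hG, (hC hG).1.inf_mem _ _ (hs hx) hy⟩
      · exact ⟨F, hF, (hC hF).1.inf_mem _ _ hx (hs hy)⟩
    · rintro x ⟨F, hF, hx⟩
      exact ⟨F, hF, (hC hF).1.primeStar_mem _ hx⟩
    · rintro ⟨F, hF, hx⟩
      exact (hC hF).2 hx

end LevelOneLaws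

/-! ### Congruences of normal filters. -/

namespace LevelOneLaws

variable {L : Type u} [HeytingAlgebra L] [HNot L]

/-- The congruence determined by a normal filter. -/
def filterSetoid {F : Set L} (hF : IsNormalFilter F) : Setoid L where
  r x y := ∃ f ∈ F, x ⊓ f = y ⊓ f
  iseqv :=
    { refl := fun _ => ⟨⊤, hF.top_mem, rfl⟩
      symm := fun ⟨f, hf, h⟩ => ⟨f, hf, h.symm⟩
      trans := fun {x y z} ⟨f, hf, h⟩ ⟨g, hg, h'⟩ => ⟨f ⊓ g, hF.inf_mem _ _ hf hg, by
        rw [← inf_assoc, h, inf_right_comm, h', inf_right_comm, inf_assoc]⟩ }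

theorem exists_common {F : Set L} (hF : IsNormalFilter F) {x y x' y' : L}
    (h : ∃ f ∈ F, x ⊓ f = y ⊓ f) (h' : ∃ f ∈ F, x' ⊓ f = y' ⊓ f) :
    ∃ f ∈ F, x ⊓ f = y ⊓ f ∧ x' ⊓ f = y' ⊓ f := by
  obtain ⟨f, hf, h⟩ := h
  obtain ⟨g, hg, h'⟩ := h'
  refine ⟨f ⊓ g, hF.inf_mem _ _ hf hg, ?_, ?_⟩
  · rw [← inf_assoc, h, inf_assoc]
  · rw [inf_comm f g, ← inf_assoc, h', inf_assoc]

variable {F : Set L} (hF : IsNormalFilter F) {x y x' y' : L}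
include hF

theorem rel_sup (h : ∃ f ∈ F, x ⊓ f = y ⊓ f) (h' : ∃ f ∈ F, x' ⊓ f = y' ⊓ f) :
    ∃ f ∈ F, (x ⊔ x') ⊓ f = (y ⊔ y') ⊓ f := by
  obtain ⟨f, hf, h1, h2⟩ := exists_common hF h h'
  exact ⟨f, hf, by rw [inf_sup_right, inf_sup_right, h1, h2]⟩

theorem rel_inf (h : ∃ f ∈ F, x ⊓ f = y ⊓ f) (h' : ∃ f ∈ F, x' ⊓ f = y' ⊓ f) :
    ∃ f ∈ F, (x ⊓ x') ⊓ f = (y ⊓ y') ⊓ f := by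
  obtain ⟨f, hf, h1, h2⟩ := exists_common hF h h'
  exact ⟨f, hf, by rw [inf_inf_distrib_right, h1, h2, ← inf_inf_distrib_right]⟩

theorem rel_himp (h : ∃ f ∈ F, x ⊓ f = y ⊓ f) (h' : ∃ f ∈ F, x' ⊓ f = y' ⊓ f) :
    ∃ f ∈ F, (x ⇨ x') ⊓ f = (y ⇨ y') ⊓ f := by
  obtain ⟨f, hf, h1, h2⟩ := exists_common hF h h'
  have key : ∀ a b a' b' : L, a ⊓ f = b ⊓ f → a' ⊓ f = b' ⊓ f → (a ⇨ a') ⊓ f ≤ (b ⇨ b') ⊓ f := by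
    intro a b a' b' h1 h2
    refine le_inf (le_himp_iff.2 ?_) inf_le_right
    calc (a ⇨ a') ⊓ f ⊓ b = (a ⇨ a') ⊓ (b ⊓ f) := by rw [inf_assoc, inf_comm f]
      _ = (a ⇨ a') ⊓ a ⊓ f := by rw [← h1, inf_assoc]
      _ ≤ a' ⊓ f := inf_le_inf_right _ himp_inf_le
      _ ≤ b' := h2 ▸ inf_le_left
  exact ⟨f, hf, le_antisymm (key _ _ _ _ h1 h2) (key _ _ _ _ h1.symm h2.symm)⟩

/-- Closure of the filter under `x ↦ x'*` is needed here: `(a ∧ f)' = a' ∨ f'`, and meeting with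
`f'*` removes the term `f'`. -/
theorem rel_prime (hL : LevelOneLaws L) (h : ∃ f ∈ F, x ⊓ f = y ⊓ f) :
    ∃ f ∈ F, ￢x ⊓ f = ￢y ⊓ f := by
  obtain ⟨f, hf, h⟩ := h
  refine ⟨_, hF.primeStar_mem f hf, ?_⟩
  have key : ∀ a : L, ￢a ⊓ (￢f)ᶜ = ￢(a ⊓ f) ⊓ (￢f)ᶜ := fun a => by
    rw [hL.inf_prime, inf_sup_right, inf_compl_self, sup_bot_eq]
  rw [key x, key y, h]

end LevelOneLaws

/-! ### From the identities of `JIDL₁` to Heyting algebras. -/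

section Bridge

variable {L : Type u} [Ops L]

/-- In the presence of linearity, a semi-Heyting algebra is a Heyting algebra. -/
theorem IsJIDL1.heyting (h : IsJIDL1 L) (x y : L) : (x ⊓ y) ⇨ y = ⊤ := by
  have idem : ∀ z : L, z ⊓ z = z := fun z => by
    simpa only [h.sup_inf_self] using h.inf_sup_self z (z ⊓ z)
  set w := y ⇨ (x ⊓ y) with hw
  have hyw : w ⊓ y = x ⊓ y := by
    rw [hw, h.inf_comm, h.sh1, h.inf_comm y, h.inf_assoc, idem]
  have hxy : w ⊓ (x ⊓ y) = x ⊓ y := by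
    rw [← hyw, ← h.inf_assoc, idem]
  -- Relative to `w` the elements `x ∧ y` and `y` coincide, so (SH2) and (SH3) put `w` below `(x ∧
  -- y) → y`. In the linearity identity `w` is then absorbed.
  have h1 : w ⊓ ((x ⊓ y) ⇨ y) = w := by rw [h.sh2, hxy, hyw, h.sh3, h.inf_top]
  have h2 := h.linear (x ⊓ y) y
  rw [← hw] at h2
  rw [← h2, ← h1, h.inf_comm w, h.sup_inf_self]

/-- The Heyting algebra underlying an algebra of the given type. -/
abbrev IsSemiHeyting.toHeyting (h : IsSemiHeyting L) (hH : ∀ x y : L, (x ⊓ y) ⇨ y = ⊤) :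
    HeytingAlgebra L :=
  let lat : Lattice L := Lattice.mk' h.sup_comm h.sup_assoc h.inf_comm h.inf_assoc
    h.sup_inf_self h.inf_sup_self
  { lat with
    himp := fun x y => x ⇨ y
    top := ⊤
    bot := ⊥
    compl := star
    le_top := fun x => inf_eq_left.1 (h.inf_top x)
    bot_le := fun x => sup_eq_left.1 (h.sup_bot x)
    le_himp_iff := fun a b c => by
      constructor
      · intro h1
        have h2 : b ⊓ (b ⇨ c) = b ⊓ c := h.sh1 b c
        calc a ⊓ b ≤ (b ⇨ c) ⊓ b := inf_le_inf_right _ h1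
          _ = b ⊓ (b ⇨ c) := h.inf_comm _ _
          _ = b ⊓ c := h2
          _ ≤ c := inf_le_right
      · intro h1
        have h2 : a ⊓ (b ⇨ c) = a ⊓ ((a ⊓ b) ⇨ (a ⊓ c)) := h.sh2 a b c
        have h3 : ((a ⊓ b) ⊓ (a ⊓ c)) ⇨ (a ⊓ c) = ⊤ := hH _ _
        have h4 : (a ⊓ b) ⊓ (a ⊓ c) = a ⊓ b := inf_eq_left.2 (le_inf inf_le_left h1)
        have h5 : a ⊓ ⊤ = a := h.inf_top a
        rw [h4] at h3
        rw [h3, h5] at h2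
        exact inf_eq_left.1 h2
    himp_bot := fun _ => rfl }

abbrev IsJIDL1.toHeyting (h : IsJIDL1 L) : HeytingAlgebra L :=
  h.toIsSemiHeyting.toHeyting h.heyting

theorem IsJIDL1.levelOneLaws (h : IsJIDL1 L) :
    letI := h.toHeyting
    LevelOneLaws L := by
  let := h.toHeyting
  exact
    { bot_prime := h.bot_prime
      top_prime := h.top_prime
      inf_prime := h.inf_prime
      sup_prime_prime := h.sup_prime_prime
      prime_prime_le := fun x => inf_eq_left.1 (h.prime_prime_le x)
      prime_sup_compl := fun x => by
        -- The distributive law at `y = x'`, `z = 0`: its right side becomes `x' → x' = 1`.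
        have h1 : ￢x ⊔ (￢x ⇨ ⊥) = (￢x ⊔ ￢x) ⇨ (￢x ⊔ ⊥) := h.jid x (￢x) ⊥
        rw [sup_idem, sup_bot_eq, himp_self, himp_bot] at h1
        exact h1
      linear := h.linear
      level_one := fun x => by
        have h1 : x ⊓ (￢x)ᶜ = x ⊓ (￢x)ᶜ ⊓ (￢(￢x)ᶜ)ᶜ := h.level_one x
        exact inf_eq_left.1 h1.symm }

end Bridge

/-! ### Subdirect decomposition into factors. -/

/-- The algebras into which every member of `JIDL₁` decomposes: dually Stone Heyting chains and
isomorphic copies of `D₂`. -/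
def IsFactor (B : Alg.{u}) : Prop :=
  (IsDStH B ∧ IsChainAlg B) ∨ ∃ g : D2.{u} → B, IsHom g ∧ Function.Bijective g

theorem isFactor_of_indecomposable {B : Alg.{u}} (h : IsJIDL1 B)
    (hi : letI := h.toHeyting; LevelOneLaws.Indecomposable B) : IsFactor B := by
  let := h.toHeyting
  have hl : LevelOneLaws B := h.levelOneLaws
  rcases hl.chain_or_four hi with ⟨h1, h2⟩ | ⟨a, h0, h1, ha, hpa, hpb, hall⟩
  · left
    refine ⟨⟨h.toIsDQD, h.heyting, fun x => ?_⟩, fun x y => ?_⟩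
    · rcases h2 x with rfl | hx
      · change ￢(⊤ : B) ⊓ ￢￢⊤ = ⊥
        rw [hl.top_prime, bot_inf_eq]
      · rw [hx]
        change ⊤ ⊓ ￢(⊤ : B) = ⊥
        rw [hl.top_prime, inf_bot_eq]
    · rcases h1 x y with hx | hx
      · exact Or.inl (inf_eq_left.2 hx)
      · exact Or.inr (inf_eq_left.2 hx)
  · right
    have hca : aᶜᶜ = a := LevelOneLaws.compl_compl_of_sup ha
    have ha' : aᶜ ⊔ a = ⊤ := by rw [sup_comm, ha]
    have hia : a ⇨ aᶜ = aᶜ := by rw [← himp_bot, himp_himp, inf_idem]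
    have hia' : aᶜ ⇨ a = a := by
      have : aᶜ ⇨ aᶜᶜ = aᶜᶜ := by rw [← himp_bot aᶜ, himp_himp, inf_idem]
      rwa [hca] at this
    have hab : a ≠ aᶜ := fun hh => h0 (by
      have := inf_compl_self a
      rwa [← hh, inf_idem] at this)
    have hb0 : aᶜ ≠ ⊥ := fun hh => h1 (by rw [← hca, hh, compl_bot])
    have hb1 : aᶜ ≠ ⊤ := fun hh => h0 (LevelOneLaws.eq_bot_of_compl_eq_top hh)
    have htb : (⊤ : B) ≠ ⊥ := fun hh => h0 (le_bot_iff.1 (hh ▸ le_top))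
    let G : Bool → Bool → B := fun p q =>
      bif p then (bif q then ⊤ else a) else (bif q then aᶜ else ⊥)
    have hsup : ∀ p q p' q', G (p ⊔ p') (q ⊔ q') = G p q ⊔ G p' q' := by
      rintro (_ | _) (_ | _) (_ | _) (_ | _) <;> simp [G, ha, ha']
    have hinf : ∀ p q p' q', G (p ⊓ p') (q ⊓ q') = G p q ⊓ G p' q' := by
      rintro (_ | _) (_ | _) (_ | _) (_ | _) <;> simp [G]
    have himp : ∀ p q p' q', G (p' || !p) (q' || !q) = G p q ⇨ G p' q' := by
      rintro (_ | _) (_ | _) (_ | _) (_ | _) <;> simp [G, hca, hia, hia']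
    have hprime : ∀ p q, G (!q) (!p) = ￢(G p q) := by
      rintro (_ | _) (_ | _) <;> simp [G, hpa, hpb, hl.bot_prime, hl.top_prime]
    have hinj : ∀ p q p' q', G p q = G p' q' → p = p' ∧ q = q' := by
      rintro (_ | _) (_ | _) (_ | _) (_ | _) <;>
        simp [G, h0, h1, h0.symm, h1.symm, hab, hab.symm, hb0, hb1, hb0.symm, hb1.symm, htb,
          htb.symm]
    refine ⟨fun x => G x.down.1 x.down.2, ⟨fun _ _ => hsup _ _ _ _, fun _ _ => hinf _ _ _ _,
      fun _ _ => himp _ _ _ _, fun _ => hprime _ _, rfl, rfl⟩, ?_, ?_⟩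
    · intro x y hxy
      obtain ⟨h2, h3⟩ := hinj _ _ _ _ hxy
      exact congrArg ULift.up (Prod.ext h2 h3)
    · intro x
      rcases hall x with rfl | rfl | rfl | rfl
      exacts [⟨⟨(false, false)⟩, rfl⟩, ⟨⟨(true, false)⟩, rfl⟩, ⟨⟨(false, true)⟩, rfl⟩,
        ⟨⟨(true, true)⟩, rfl⟩]

/-- The quotient of an algebra in `JIDL₁` by a normal filter. -/
def quotientAlg {A : Alg.{u}} (h : IsJIDL1 A) {F : Set A}
    (hF : letI := h.toHeyting; LevelOneLaws.IsNormalFilter F) : Alg.{u} :=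
  letI := h.toHeyting
  letI S := LevelOneLaws.filterSetoid hF
  { carrier := Quotient S
    ops :=
      { max := Quotient.map₂ (· ⊔ ·) fun _ _ h1 _ _ h2 => LevelOneLaws.rel_sup hF h1 h2
        min := Quotient.map₂ (· ⊓ ·) fun _ _ h1 _ _ h2 => LevelOneLaws.rel_inf hF h1 h2
        himp := Quotient.map₂ (· ⇨ ·) fun _ _ h1 _ _ h2 => LevelOneLaws.rel_himp hF h1 h2
        hnot := Quotient.map (fun x => ￢x) fun _ _ h1 =>
          LevelOneLaws.rel_prime hF h.levelOneLaws h1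
        bot := Quotient.mk S ⊥
        top := Quotient.mk S ⊤ } }

theorem exists_quotient {A : Alg.{u}} (h : IsJIDL1 A) {F : Set A}
    (hF : letI := h.toHeyting; LevelOneLaws.IsNormalFilter F) :
    ∃ (B : Alg.{u}) (f : A → B), IsHom f ∧ Function.Surjective f ∧
      ∀ x y, f x = f y ↔ ∃ g ∈ F, x ⊓ g = y ⊓ g := by
  let := h.toHeyting
  let S := LevelOneLaws.filterSetoid hF
  exact ⟨quotientAlg h hF, Quotient.mk S,
    ⟨fun _ _ => rfl, fun _ _ => rfl, fun _ _ => rfl, fun _ => rfl, rfl, rfl⟩,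
    Quotient.mk_surjective, fun x y => Quotient.eq⟩

/-- Every element of an algebra in `JIDL₁` besides the top is separated from the top by a
homomorphism onto a factor. -/
theorem exists_factor {A : Alg.{u}} (h : IsJIDL1 A) {e : A} (he : e ≠ ⊤) :
    ∃ (B : Alg.{u}) (f : A → B), IsHom f ∧ Function.Surjective f ∧ IsFactor B ∧ f e ≠ ⊤ := by
  let := h.toHeyting
  have hl : LevelOneLaws A := h.levelOneLaws
  obtain ⟨F, hF, heF, hmax⟩ := hl.exists_maximal_normalFilter he
  obtain ⟨B, f, hf, hs, hker⟩ := exists_quotient h hF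
  have hB : IsJIDL1 B := h.image hf hs
  have htop : ∀ x, f x = ⊤ → x ∈ F := by
    intro x hx
    obtain ⟨g, hg, hxg⟩ := (hker x ⊤).1 (hx.trans hf.map_top.symm)
    rw [top_inf_eq] at hxg
    exact hF.mem_of_le _ _ (inf_eq_right.1 hxg) hg
  have hmem : ∀ x ∈ F, f x = ⊤ := fun x hx =>
    ((hker x ⊤).2 ⟨x, hx, by rw [inf_idem, top_inf_eq]⟩).trans hf.map_top
  refine ⟨B, f, hf, hs, isFactor_of_indecomposable hB ?_, fun hh => heF (htop _ hh)⟩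
  let := hB.toHeyting
  have hlB : LevelOneLaws B := hB.levelOneLaws
  refine hlB.indecomposable_of_monolith (e := f e) (fun hh => heF (htop _ hh)) fun G hG heG => ?_
  -- The preimage of `G` is normal, contains `F` and omits `e`, so by maximality it lies in `F`,
  -- whose image is `{1}`.
  have hpre : LevelOneLaws.IsNormalFilter (f ⁻¹' G) := by
    have hinf : ∀ x y, f (x ⊓ y) = f x ⊓ f y := hf.map_inf
    have hstar : ∀ x, f (￢x)ᶜ = (￢f x)ᶜ := fun x => by
      have h1 : f (￢x ⇨ ⊥) = f (￢x) ⇨ f ⊥ := hf.map_himp _ _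
      rw [hf.map_bot, hf.map_prime] at h1
      exact h1
    refine ⟨?_, fun x y hxy hx => hG.mem_of_le _ _ ?_ hx,
      fun x y hx hy => ?_, fun x hx => ?_⟩
    · change f ⊤ ∈ G
      rw [hf.map_top]
      exact hG.top_mem
    · have h1 := hinf x y
      rw [inf_eq_left.2 hxy] at h1
      exact inf_eq_left.1 h1.symm
    · change f (x ⊓ y) ∈ G
      rw [hinf]
      exact hG.inf_mem _ _ hx hy
    · change f (￢x)ᶜ ∈ G
      rw [hstar]
      exact hG.primeStar_mem _ hx
  intro y hy
  obtain ⟨x, rfl⟩ := hs y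
  refine hmem x (hmax _ hpre heG (fun z hz => ?_) hy)
  change f z ∈ G
  rw [hmem z hz]
  exact hG.top_mem

/-- A member of `JIDL₁` belongs to a variety as soon as its factors do. -/
theorem mem_of_factors {A : Alg.{u}} (h : IsJIDL1 A) (V : Variety.{u})
    (hV : ∀ (B : Alg.{u}) (f : A → B), IsHom f → Function.Surjective f → IsFactor B →
      B ∈ V.carrier) : A ∈ V.carrier := by
  choose B f hf hs hB hne using fun e : {e : A // e ≠ ⊤} => exists_factor h e.2
  refine V.sub_mem A (Alg.pi B) (fun x i => f i x) ?_ ?_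
    (V.pi_mem _ B fun i => hV _ (f i) (hf i) (hs i) (hB i))
  · exact ⟨fun x y => funext fun i => (hf i).map_sup x y,
      fun x y => funext fun i => (hf i).map_inf x y,
      fun x y => funext fun i => (hf i).map_himp x y,
      fun x => funext fun i => (hf i).map_prime x,
      funext fun i => (hf i).map_bot, funext fun i => (hf i).map_top⟩
  · intro x y hxy
    let := h.toHeyting
    -- If `x → y ≠ 1`, the factor chosen for this element keeps it different from `1`; yet `x` and
    -- `y` have the same image there, so `x → y` goes to `1`.
    have key : ∀ x y : A, (fun i => f i x) = (fun i => f i y) → x ⇨ y = ⊤ := by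
      intro x y hxy
      by_contra hne'
      refine hne ⟨x ⇨ y, hne'⟩ ?_
      have h1 := congrFun hxy ⟨x ⇨ y, hne'⟩
      have h2 : f ⟨x ⇨ y, hne'⟩ (x ⇨ y) = f ⟨x ⇨ y, hne'⟩ x ⇨ f ⟨x ⇨ y, hne'⟩ y :=
        (hf _).map_himp x y
      rw [h2, h1]
      exact (h.image (hf _) (hs _)).sh3 _
    exact le_antisymm (himp_eq_top_iff.1 (key x y hxy)) (himp_eq_top_iff.1 (key y x hxy.symm))

/-! ### Subalgebras and eventual ranges. -/

/-- A subset closed under the operations. -/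
structure IsSubuniverse {A : Alg.{u}} (P : A → Prop) : Prop where
  sup_mem : ∀ x y, P x → P y → P (x ⊔ y)
  inf_mem : ∀ x y, P x → P y → P (x ⊓ y)
  himp_mem : ∀ x y, P x → P y → P (x ⇨ y)
  prime_mem : ∀ x, P x → P (￢x)
  bot_mem : P ⊥
  top_mem : P ⊤

/-- The subalgebra on a subuniverse. -/
def Alg.sub {A : Alg.{u}} {P : A → Prop} (h : IsSubuniverse P) : Alg.{u} where
  carrier := {x : A // P x}
  ops :=
    { max := fun x y => ⟨x.1 ⊔ y.1, h.sup_mem _ _ x.2 y.2⟩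
      min := fun x y => ⟨x.1 ⊓ y.1, h.inf_mem _ _ x.2 y.2⟩
      himp := fun x y => ⟨x.1 ⇨ y.1, h.himp_mem _ _ x.2 y.2⟩
      hnot := fun x => ⟨￢x.1, h.prime_mem _ x.2⟩
      bot := ⟨⊥, h.bot_mem⟩
      top := ⟨⊤, h.top_mem⟩ }

theorem Alg.sub_mem {A : Alg.{u}} {P : A → Prop} (h : IsSubuniverse P) {V : Variety.{u}}
    (hA : A ∈ V.carrier) : Alg.sub h ∈ V.carrier :=
  V.sub_mem (Alg.sub h) A Subtype.val
    ⟨fun _ _ => rfl, fun _ _ => rfl, fun _ _ => rfl, fun _ => rfl, rfl, rfl⟩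
    Subtype.val_injective hA

/-- If the homomorphisms `g i : B i → A` eventually hit every element of `A`, then `A` belongs to
every variety containing all the `B i`. -/
theorem mem_of_eventually_range {A : Alg.{u}} (V : Variety.{u}) {ι : Type u} (l : Filter ι)
    [l.NeBot] (B : ι → Alg.{u}) (g : ∀ i, B i → A) (hg : ∀ i, IsHom (g i))
    (hr : ∀ x, ∀ᶠ i in l, x ∈ Set.range (g i)) (hB : ∀ i, B i ∈ V.carrier) :
    A ∈ V.carrier := by
  -- the elements of the product whose images in `A` are eventually constant
  let P : Alg.pi B → Prop := fun c => ∃ x, ∀ᶠ i in l, g i (c i) = x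
  have hP : IsSubuniverse P := by
    refine ⟨?_, ?_, ?_, ?_, ⟨⊥, .of_forall fun i => (hg i).map_bot⟩,
      ⟨⊤, .of_forall fun i => (hg i).map_top⟩⟩
    · rintro c d ⟨x, hx⟩ ⟨y, hy⟩
      exact ⟨x ⊔ y, (hx.and hy).mono fun i hi =>
        ((hg i).map_sup _ _).trans (congrArg₂ (· ⊔ ·) hi.1 hi.2)⟩
    · rintro c d ⟨x, hx⟩ ⟨y, hy⟩
      exact ⟨x ⊓ y, (hx.and hy).mono fun i hi =>
        ((hg i).map_inf _ _).trans (congrArg₂ (· ⊓ ·) hi.1 hi.2)⟩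
    · rintro c d ⟨x, hx⟩ ⟨y, hy⟩
      exact ⟨x ⇨ y, (hx.and hy).mono fun i hi =>
        ((hg i).map_himp _ _).trans (congrArg₂ (· ⇨ ·) hi.1 hi.2)⟩
    · rintro c ⟨x, hx⟩
      exact ⟨￢x, hx.mono fun i hi => ((hg i).map_prime _).trans (congrArg _ hi)⟩
  choose F hF using fun c : Alg.sub hP => c.2
  -- Eventual values are unique because the filter is proper; this makes `F` compatible with the
  -- operations.
  have huniq : ∀ (c : Alg.sub hP) (x : A), (∀ᶠ i in l, g i (c.1 i) = x) → F c = x := by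
    intro c x hx
    obtain ⟨i, h1, h2⟩ := ((hF c).and hx).exists
    exact h1.symm.trans h2
  refine V.image_mem (Alg.sub hP) A F ⟨?_, ?_, ?_, ?_, ?_, ?_⟩ ?_
    (Alg.sub_mem hP (V.pi_mem ι B hB))
  · exact fun c d => huniq _ _ (((hF c).and (hF d)).mono fun i hi =>
      ((hg i).map_sup _ _).trans (congrArg₂ (· ⊔ ·) hi.1 hi.2))
  · exact fun c d => huniq _ _ (((hF c).and (hF d)).mono fun i hi =>
      ((hg i).map_inf _ _).trans (congrArg₂ (· ⊓ ·) hi.1 hi.2))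
  · exact fun c d => huniq _ _ (((hF c).and (hF d)).mono fun i hi =>
      ((hg i).map_himp _ _).trans (congrArg₂ (· ⇨ ·) hi.1 hi.2))
  · exact fun c => huniq _ _ ((hF c).mono fun i hi =>
      ((hg i).map_prime _).trans (congrArg _ hi))
  · exact huniq _ _ (Filter.Eventually.of_forall fun i => (hg i).map_bot)
  · exact huniq _ _ (Filter.Eventually.of_forall fun i => (hg i).map_top)
  · intro x
    have hc : ∀ i, ∃ c : B i, x ∈ Set.range (g i) → g i c = x := fun i => by
      by_cases h : x ∈ Set.range (g i)
      · obtain ⟨c, hc⟩ := h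
        exact ⟨c, fun _ => hc⟩
      -- An arbitrary default: indices whose range misses `x` do not affect the eventual value.
      · exact ⟨⊥, fun h' => absurd h' h⟩
    choose c hc using hc
    have hev : ∀ᶠ i in l, g i (c i) = x := (hr x).mono fun i hi => hc i hi
    exact ⟨⟨c, x, hev⟩, huniq _ _ hev⟩

/-! ### Dually Stone chains and their finite subchains. -/

section Chains

abbrev IsDStH.toHeyting {L : Type u} [Ops L] (h : IsDStH L) : HeytingAlgebra L :=
  h.toIsSemiHeyting.toHeyting h.heyting

variable {L : Type u} [Ops L]

/-- In a chain `x' ∧ x'' = 0` makes one of the two terms `0`. If `x' = 0` then `1 = x'' ≤ x`; if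
`x'' = 0` then `1 = x''' ≤ x'`. -/
theorem IsDStH.prime_eq_top (h : IsDStH L) (hc : IsChainAlg L) {x : L} (hx : x ≠ ⊤) :
    ￢x = ⊤ := by
  let := h.toHeyting
  have hle : ￢￢x ≤ x := inf_eq_left.1 (h.prime_prime_le x)
  have h0 : ￢x = ⊥ → x = ⊤ := fun h1 => by
    rw [h1] at hle
    have h2 : ￢(⊥ : L) = ⊤ := h.bot_prime
    rw [h2] at hle
    exact top_le_iff.1 hle
  have hs : ￢x ⊓ ￢￢x = ⊥ := h.dualStone x
  rcases hc (￢x) (￢￢x) with h1 | h1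
  · exact absurd (h0 (h1.symm.trans hs)) hx
  · have h2 : ￢￢x = ⊥ := by rw [← hs, inf_comm]; exact h1.symm
    have h3 : ￢￢￢x = ⊤ := by rw [h2]; exact h.bot_prime
    exact top_le_iff.1 (h3 ▸ inf_eq_left.1 (h.prime_prime_le (￢x)))

theorem IsDStH.isJIDL1 (h : IsDStH L) (hc : IsChainAlg L) : IsJIDL1 L := by
  let := h.toHeyting
  have htp : ￢(⊤ : L) = ⊥ := h.top_prime
  have hprime : ∀ x : L, x = ⊤ ∨ ￢x = ⊤ := fun x => by
    by_cases hx : x = ⊤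
    exacts [Or.inl hx, Or.inr (h.prime_eq_top hc hx)]
  refine ⟨h.toIsDQD, fun x y z => ?_, fun x y => ?_, fun x => ?_⟩
  · rcases hprime x with rfl | hx
    · simp [htp]
    · simp [hx]
  · rcases hc x y with h1 | h1
    · rw [himp_eq_top_iff.2 (inf_eq_left.1 h1), top_sup_eq]
    · rw [himp_eq_top_iff.2 (inf_eq_left.1 h1), sup_top_eq]
  · change x ⊓ (￢x)ᶜ = x ⊓ (￢x)ᶜ ⊓ (￢(￢x)ᶜ)ᶜ
    rcases hprime x with rfl | hx
    · simp [htp]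
    · simp [hx]

theorem IsDStH.himp_of_not_le (h : IsDStH L) (hc : IsChainAlg L) {x y : L} (hxy : x ⊓ y ≠ x) :
    x ⇨ y = y := by
  let := h.toHeyting
  have hxy' : ¬ x ≤ y := fun h1 => hxy (inf_eq_left.2 h1)
  change (x ⇨ y) = y
  refine le_antisymm ?_ le_himp
  rcases hc (x ⇨ y) x with h1 | h1
  · rw [← h1]; exact himp_inf_le
  · exact absurd (le_himp_iff'.1 (inf_eq_left.1 h1)) (fun h2 => hxy' (by simpa using h2))

theorem IsDStH.himp_of_le (h : IsDStH L) {x y : L} (hxy : x ⊓ y = x) : x ⇨ y = ⊤ := by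
  rw [← hxy]; exact h.heyting x y

end Chains

namespace Cdp

variable {n : ℕ} [NeZero n]

theorem down_sup (x y : Cdp.{u} n) : (x ⊔ y).down = max x.down y.down := rfl
theorem down_inf (x y : Cdp.{u} n) : (x ⊓ y).down = min x.down y.down := rfl
theorem down_himp (x y : Cdp.{u} n) :
    (x ⇨ y).down = if x.down ≤ y.down then ⊤ else y.down :=
  apply_ite ULift.down _ _ _
theorem down_prime (x : Cdp.{u} n) : (￢x).down = if x.down = ⊤ then 0 else ⊤ :=
  apply_ite ULift.down _ _ _
theorem down_bot : (⊥ : Cdp.{u} n).down = 0 := rfl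
theorem down_top : (⊤ : Cdp.{u} n).down = ⊤ := rfl

theorem ext {x y : Cdp.{u} n} (h : x.down = y.down) : x = y := ULift.ext _ _ h

theorem isDStH : IsDStH (Cdp.{u} n) := by
  have h1 : ∀ i : Fin n, i ≤ ⊤ := fun _ => le_top
  have h2 : ∀ i : Fin n, 0 ≤ i := fun _ => Fin.zero_le _
  constructor
  · constructor
    · constructor
      all_goals intros
      all_goals apply ext
      all_goals simp only [down_sup, down_inf, down_himp, down_bot, down_top]
      all_goals grind
    all_goals intros
    all_goals apply ext
    all_goals simp only [down_sup, down_inf, down_prime, down_bot, down_top]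
    all_goals grind
  all_goals intros
  all_goals apply ext
  all_goals simp only [down_inf, down_himp, down_prime, down_bot, down_top]
  all_goals grind

theorem isChainAlg : IsChainAlg (Cdp.{u} n) := fun x y => by
  rcases le_total x.down y.down with h | h
  · exact Or.inl (ext (min_eq_left h))
  · exact Or.inr (ext (min_eq_left h))

/-- In a dually Stone chain the order and the two bounds determine all operations, so an order
embedding preserving the bounds preserves everything. -/
theorem isHom_of_injective {A : Alg.{u}} (h : IsDStH A) (hc : IsChainAlg A) {g : Cdp.{u} n → A}
    (hi : Function.Injective g) (hm : ∀ x y, x.down ≤ y.down → g x ⊓ g y = g x)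
    (hbot : g ⊥ = ⊥) (htop : g ⊤ = ⊤) : IsHom g := by
  have hsup : ∀ x y, x.down ≤ y.down → g x ⊔ g y = g y := fun x y hxy => by
    rw [← hm x y hxy, h.inf_comm, h.sup_comm, h.sup_inf_self]
  have hnle : ∀ x y, ¬ x.down ≤ y.down → g x ⊓ g y ≠ g x := fun x y hxy hxy' => by
    have h1 := hm y x (le_of_not_ge hxy)
    rw [h.inf_comm, hxy'] at h1
    exact hxy (hi h1 ▸ le_rfl)
  refine ⟨fun x y => ?_, fun x y => ?_, fun x y => ?_, fun x => ?_, hbot, htop⟩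
  · rcases le_total x.down y.down with h1 | h1
    · rw [hsup x y h1]; exact congrArg g (ext (max_eq_right h1))
    · rw [h.sup_comm, hsup y x h1]; exact congrArg g (ext (max_eq_left h1))
  · rcases le_total x.down y.down with h1 | h1
    · rw [hm x y h1]; exact congrArg g (ext (min_eq_left h1))
    · rw [h.inf_comm, hm y x h1]; exact congrArg g (ext (min_eq_right h1))
  · by_cases h1 : x.down ≤ y.down
    · rw [h.himp_of_le (hm x y h1), ← htop]
      exact congrArg g (ext (by rw [down_himp, if_pos h1, down_top]))
    · rw [h.himp_of_not_le hc (hnle x y h1)]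
      exact congrArg g (ext (by rw [down_himp, if_neg h1]))
  · by_cases h1 : x.down = ⊤
    · have hx : x = ⊤ := ext h1
      rw [hx, htop, h.top_prime, ← hbot]
      exact congrArg g (ext (by rw [down_prime, if_pos down_top, down_bot]))
    · have hx : g x ≠ ⊤ := fun h2 => h1 (hi (h2.trans htop.symm) ▸ down_top)
      rw [h.prime_eq_top hc hx, ← htop]
      exact congrArg g (ext (by rw [down_prime, if_neg h1, down_top]))

end Cdp

theorem exists_embedding {A : Alg.{u}} (h : IsDStH A) (hc : IsChainAlg A) (S : Finset A) :
    ∃ (k : ℕ) (g : Cdp.{u} (k + 1) → A), IsHom g ∧ Function.Injective g ∧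
      ∀ x ∈ S, x ∈ Set.range g := by
  classical
  let := h.toHeyting
  have : @Std.Total A (· ≤ ·) := ⟨fun x y => (hc x y).imp inf_eq_left.1 inf_eq_left.1⟩
  let : LinearOrder A := Lattice.toLinearOrder A
  -- Adjoining the bounds makes the increasing enumeration of `T` preserve them.
  let T : Finset A := insert ⊥ (insert ⊤ S)
  obtain ⟨k, hk⟩ : ∃ k, T.card = k + 1 :=
    Nat.exists_eq_succ_of_ne_zero (Finset.card_ne_zero_of_mem (Finset.mem_insert_self _ _))
  let e := T.orderEmbOfFin hk
  have hr : ∀ x ∈ T, ∃ i, e i = x := fun x hx => by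
    have h1 : x ∈ Set.range (T.orderEmbOfFin hk) := by
      rw [Finset.range_orderEmbOfFin]; exact hx
    exact h1
  have hbot : e 0 = ⊥ := by
    obtain ⟨i, hi⟩ := hr ⊥ (by simp [T])
    exact le_bot_iff.1 (hi ▸ e.monotone (Fin.zero_le i))
  have htop : e ⊤ = ⊤ := by
    obtain ⟨i, hi⟩ := hr ⊤ (by simp [T])
    exact top_le_iff.1 (hi ▸ e.monotone le_top)
  refine ⟨k, fun x => e x.down, ?_, ?_, ?_⟩
  · exact Cdp.isHom_of_injective h hc (fun x y hxy => Cdp.ext (e.injective hxy))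
      (fun x y hxy => inf_eq_left.2 (e.monotone hxy)) hbot htop
  · exact fun x y hxy => Cdp.ext (e.injective hxy)
  · intro x hx
    obtain ⟨i, hi⟩ := hr x (by simp [T, hx])
    exact ⟨⟨i⟩, hi⟩

/-- A dually Stone Heyting chain belongs to every variety that contains its finite subchains. -/
theorem chain_mem {A : Alg.{u}} (h : IsDStH A) (hc : IsChainAlg A) (V : Variety.{u})
    (hV : ∀ (k : ℕ) (g : Cdp.{u} (k + 1) → A), IsHom g → Function.Injective g →
      Cdp.{u} (k + 1) ∈ V.carrier) : A ∈ V.carrier := by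
  choose k g hg hi hr using exists_embedding h hc
  -- Indexing by finite subsets, each `x` is in the range from `{x}` onwards.
  refine mem_of_eventually_range V (Filter.atTop : Filter (Finset A)) (fun S => Cdp (k S + 1)) g hg
    (fun x => ?_) (fun S => hV _ (g S) (hg S) (hi S))
  filter_upwards [Filter.eventually_ge_atTop {x}] with S hS
  exact hr S x (hS (Finset.mem_singleton_self x))

namespace D2

theorem ext {x y : D2.{u}} (h1 : x.down.1 = y.down.1) (h2 : x.down.2 = y.down.2) : x = y :=
  ULift.ext _ _ (Prod.ext h1 h2)

theorem isJIDL1 : IsJIDL1 D2.{u} := by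
  refine ⟨⟨⟨?_, ?_, ?_, ?_, ?_, ?_, ?_, ?_, ?_, ?_, ?_⟩, ?_, ?_, ?_, ?_, ?_⟩, ?_, ?_, ?_⟩
  any_goals
    first
    | rfl
    | (rintro ⟨_ | _, _ | _⟩; all_goals rfl)
    | (rintro ⟨_ | _, _ | _⟩ ⟨_ | _, _ | _⟩; all_goals rfl)
    | (rintro ⟨_ | _, _ | _⟩ ⟨_ | _, _ | _⟩ ⟨_ | _, _ | _⟩; all_goals rfl)

end D2

/-! ### Ladder identities and strata. -/

/-- `(x₀ → x₁) ∨ (x₁ → x₂) ∨ ⋯ ∨ (xₙ₋₁ → xₙ)`. -/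
def ladder {L : Type u} [Ops L] (x : ℕ → L) : ℕ → L
  | 0 => ⊥
  | n + 1 => ladder x n ⊔ (x n ⇨ x (n + 1))

theorem IsHom.map_ladder {L M : Type u} [Ops L] [Ops M] {f : L → M} (hf : IsHom f) (x : ℕ → L)
    (n : ℕ) : f (ladder x n) = ladder (fun i => f (x i)) n := by
  induction n with
  | zero => exact hf.map_bot
  | succ n ih => rw [ladder, ladder, hf.map_sup, ih, hf.map_himp]

theorem Alg.isHom_eval {ι : Type u} (A : ι → Alg.{u}) (i : ι) :
    IsHom (fun x : Alg.pi A => x i) :=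
  ⟨fun _ _ => rfl, fun _ _ => rfl, fun _ _ => rfl, fun _ => rfl, rfl, rfl⟩

theorem ladder_succ_eq_top {A : Alg.{u}} (h : IsSemiHeyting A) {x : ℕ → A} {n m : ℕ}
    (hnm : n ≤ m) (hx : ladder x n = ⊤) : ladder x m = ⊤ := by
  induction m, hnm using Nat.le_induction with
  | base => exact hx
  | succ m _ ih =>
    rw [ladder, ih]
    have := h.sup_inf_self ⊤ (x m ⇨ x (m + 1))
    rw [← this, h.inf_comm, h.inf_top, h.sup_assoc]
    congr 1
    have h1 := h.sup_inf_self (x m ⇨ x (m + 1)) ⊤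
    rwa [h.inf_top] at h1

/-- The subvariety of `JIDL₁` given by bounding the length of chains by `k + 2` and, if `d = 0`,
the dual Stone identity. -/
def stratum (k : WithTop ℕ) (d : Fin 2) : Variety.{u} where
  carrier := {A | IsJIDL1 A ∧ (∀ m : ℕ, k ≤ m → ∀ x : ℕ → A, ladder x (m + 2) = ⊤) ∧
    (d = 0 → ∀ x : A, ￢x ⊓ ￢￢x = ⊥)}
  image_mem := by
    rintro A B f hf hs ⟨h1, h2, h3⟩
    refine ⟨h1.image hf hs, fun m hm x => ?_, fun hd x => ?_⟩
    · choose y hy using fun i => hs (x i)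
      rw [← hf.map_top, ← h2 m hm y, hf.map_ladder]
      simp only [hy]
    · obtain ⟨x, rfl⟩ := hs x
      rw [← hf.map_prime, ← hf.map_prime, ← hf.map_inf, h3 hd, hf.map_bot]
  sub_mem := by
    rintro A B f hf hi ⟨h1, h2, h3⟩
    refine ⟨h1.sub hf hi, fun m hm x => hi ?_, fun hd x => hi ?_⟩
    · rw [hf.map_ladder, h2 m hm, hf.map_top]
    · rw [hf.map_inf, hf.map_prime (￢x), hf.map_prime, h3 hd, hf.map_bot]
  pi_mem := by
    refine fun ι A hA => ⟨IsJIDL1.pi fun i => (hA i).1, fun m hm x => funext fun i => ?_,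
      fun hd x => funext fun i => (hA i).2.2 hd (x i)⟩
    exact ((Alg.isHom_eval A i).map_ladder x _).trans ((hA i).2.1 m hm _)

theorem stratum_le (k : WithTop ℕ) (d : Fin 2) : stratum.{u} k d ≤ JIDL1 := fun _ hA => hA.1

theorem stratum_mono {k k' : WithTop ℕ} {d d' : Fin 2} (hk : k ≤ k') (hd : d ≤ d') :
    stratum.{u} k d ≤ stratum k' d' := fun _ hA =>
  ⟨hA.1, fun m hm => hA.2.1 m (hk.trans hm), fun h => hA.2.2 (by
    rw [h] at hd
    exact le_antisymm hd (Fin.zero_le _))⟩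

namespace Cdp

theorem top_val (j : ℕ) : ((⊤ : Fin (j + 1)) : ℕ) = j := rfl

theorem isJIDL1 {n : ℕ} [NeZero n] : IsJIDL1 (Cdp.{u} n) := isDStH.isJIDL1 isChainAlg

theorem sup_ne_top {n : ℕ} [NeZero n] {x y : Cdp.{u} n} : x ⊔ y ≠ ⊤ ↔ x ≠ ⊤ ∧ y ≠ ⊤ := by
  have key : ∀ z : Cdp.{u} n, z = ⊤ ↔ z.down = ⊤ := fun z => ⟨fun h => by rw [h, down_top], ext⟩
  rw [Ne, Ne, Ne, key, key, key, down_sup, ← not_or, not_iff_not]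
  have h1 : ∀ i : Fin n, i ≤ ⊤ := fun _ => le_top
  grind

theorem himp_eq_top {n : ℕ} [NeZero n] {x y : Cdp.{u} n} (h : x.down ≤ y.down) : x ⇨ y = ⊤ :=
  ext (by rw [down_himp, if_pos h, down_top])

theorem himp_eq_right {n : ℕ} [NeZero n] {x y : Cdp.{u} n} (h : ¬ x.down ≤ y.down) : x ⇨ y = y :=
  ext (by rw [down_himp, if_neg h])

/-- In a chain a join differs from `1` only if every term does, so each rung must be a strict
descent, costing at least one position. -/
theorem val_add_le_of_ladder_ne_top {n : ℕ} [NeZero n] (x : ℕ → Cdp.{u} n) (m : ℕ)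
    (h : ladder x m ≠ ⊤) : (x m).down.val + m ≤ (x 0).down.val := by
  induction m with
  | zero => exact le_rfl
  | succ m ih =>
    obtain ⟨h1, h2⟩ := sup_ne_top.1 h
    have h3 : ¬ (x m).down ≤ (x (m + 1)).down := fun h3 => h2 (himp_eq_top h3)
    have := ih h1
    rw [Fin.le_def] at h3
    omega

/-- The strictly decreasing enumeration of a finite chain. -/
def descending (j : ℕ) (i : ℕ) : Cdp.{u} (j + 2) := ⟨⟨j + 1 - i, by omega⟩⟩

theorem ladder_descending_ne_top (j m : ℕ) (hm : m ≤ j + 1) :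
    ladder (descending.{u} j) m ≠ ⊤ := by
  induction m with
  | zero =>
    intro h
    have h1 : ((0 : Fin (j + 2)) : ℕ) = j + 1 := congrArg (fun z : Cdp.{u} (j + 2) => z.down.val) h
    simp at h1
  | succ m ih =>
    refine sup_ne_top.2 ⟨ih (by omega), ?_⟩
    rw [himp_eq_right (by rw [Fin.le_def]; simp only [descending]; omega)]
    intro h
    have h1 : j + 1 - (m + 1) = j + 1 := congrArg (fun z : Cdp.{u} (j + 2) => z.down.val) h
    omega

/-- The longest strict descent among `j + 2` elements has `j + 1` steps, so a ladder of `m + 2`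
rungs is refuted exactly when `m < j`. -/
theorem mem_stratum_iff {j : ℕ} {k : WithTop ℕ} {d : Fin 2} :
    Cdp.{u} (j + 2) ∈ (stratum k d).carrier ↔ (j : WithTop ℕ) ≤ k := by
  constructor
  · rintro ⟨-, h, -⟩
    by_contra hk
    rw [not_le] at hk
    obtain ⟨m, rfl⟩ := WithTop.ne_top_iff_exists.1 (ne_top_of_lt hk)
    have hmj : m < j := WithTop.coe_lt_coe.1 hk
    exact ladder_descending_ne_top j (m + 2) (by omega) (h m le_rfl _)
  · intro hk
    refine ⟨isJIDL1, fun m hm x => ?_, fun _ => isDStH.dualStone⟩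
    by_contra h
    have h1 := val_add_le_of_ladder_ne_top x _ h
    have h2 := (x 0).down.isLt
    have h3 : j ≤ m := by exact_mod_cast hk.trans hm
    omega

theorem mem_of_le {V : Variety.{u}} {i j : ℕ} (hij : i ≤ j)
    (h : Cdp.{u} (j + 2) ∈ V.carrier) : Cdp.{u} (i + 2) ∈ V.carrier := by
  -- The top goes to the top and every other element keeps its position.
  let g : Cdp.{u} (i + 2) → Cdp.{u} (j + 2) := fun x =>
    ⟨⟨if x.down.val = i + 1 then j + 1 else x.down.val, by
      have := x.down.isLt
      split_ifs <;> omega⟩⟩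
  have hval : ∀ x, (g x).down.val = if x.down.val = i + 1 then j + 1 else x.down.val :=
    fun _ => rfl
  have hi : Function.Injective g := by
    intro x y hxy
    have h1 := congrArg (fun z : Cdp.{u} (j + 2) => z.down.val) hxy
    simp only [hval] at h1
    have hx := x.down.isLt
    have hy := y.down.isLt
    apply ext
    apply Fin.ext
    split_ifs at h1 <;> omega
  refine V.sub_mem _ _ g (isHom_of_injective isDStH isChainAlg hi (fun x y hxy => ?_)
    ?_ ?_) hi h
  · apply ext
    rw [down_inf]
    apply min_eq_left
    rw [Fin.le_def, hval, hval]
    rw [Fin.le_def] at hxy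
    have hx := x.down.isLt
    have hy := y.down.isLt
    split_ifs <;> omega
  · apply ext
    apply Fin.ext
    rw [hval, down_bot, down_bot]
    simp
  · apply ext
    apply Fin.ext
    rw [hval, down_top, down_top, top_val, top_val, if_pos rfl]

end Cdp

/-- Two consecutive rungs dominate `b` and `b*` for their shared element `b`, so in a Boolean
algebra any ladder of at least two rungs is `1`; this is why the bounds in `stratum` start at length
2. The dual Stone identity fails at `a`, where `a' ∧ a'' = a`. -/
theorem D2.mem_stratum_iff {k : WithTop ℕ} {d : Fin 2} :
    D2.{u} ∈ (stratum k d).carrier ↔ d = 1 := by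
  constructor
  · rintro ⟨-, -, h⟩
    by_contra hd
    have h1 := h (by omega) ⟨(true, false)⟩
    exact absurd (congrArg (fun z : D2.{u} => z.down.1) h1) (by decide)
  · rintro rfl
    refine ⟨isJIDL1, fun m _ x => ladder_succ_eq_top isJIDL1.toIsSemiHeyting (n := 2) (by omega) ?_,
      fun h => absurd h (by decide)⟩
    have key : ∀ a b c : D2.{u}, (⊥ ⊔ (a ⇨ b)) ⊔ (b ⇨ c) = ⊤ := by
      rintro ⟨_ | _, _ | _⟩ ⟨_ | _, _ | _⟩ ⟨_ | _, _ | _⟩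
      all_goals rfl
    exact key _ _ _

/-! ### Classification of the subvarieties. -/

theorem mem_of_subsingleton {A : Alg.{u}} [Subsingleton A] (V : Variety.{u}) : A ∈ V.carrier := by
  refine V.sub_mem A (Alg.pi (PEmpty.elim : PEmpty.{u + 1} → Alg.{u})) (fun _ i => i.elim)
    ?_ (Function.injective_of_subsingleton _) (V.pi_mem _ _ fun i => i.elim)
  constructor
  all_goals intros
  all_goals funext i
  all_goals exact i.elim

/-- A subvariety of `JIDL₁` is determined by `D₂` and the finite chains that it contains. -/
theorem le_of_generators {V W : Variety.{u}} (hV : V ≤ JIDL1)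
    (hD : D2.{u} ∈ V.carrier → D2.{u} ∈ W.carrier)
    (hC : ∀ j : ℕ, Cdp.{u} (j + 2) ∈ V.carrier → Cdp.{u} (j + 2) ∈ W.carrier) : V ≤ W := by
  intro A hA
  refine mem_of_factors (hV hA) W fun B f hf hs hB => ?_
  have hBV : B ∈ V.carrier := V.image_mem A B f hf hs hA
  rcases hB with ⟨h1, h2⟩ | ⟨g, hg, hbij⟩
  · refine chain_mem h1 h2 W fun k g hg hi => ?_
    rcases k with _ | k
    · have : Subsingleton (Cdp.{u} (0 + 1)) :=
        ⟨fun x y => Cdp.ext (Subsingleton.elim (α := Fin 1) _ _)⟩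
      exact mem_of_subsingleton W
    · exact hC k (V.sub_mem _ B g hg hi hBV)
  · exact W.image_mem _ B g hg hbij.2 (hD (V.sub_mem _ B g hg hbij.1 hBV))

/-- The bounds `{0, 1}` form a subalgebra. Hence every nontrivial subvariety contains the
two-element chain, which detects nontriviality. -/
theorem Cdp.two_mem_of_nontrivial {V : Variety.{u}} {A : Alg.{u}} (hA : IsJIDL1 A)
    [Nontrivial A] (hV : A ∈ V.carrier) : Cdp.{u} 2 ∈ V.carrier := by
  let := (Cdp.isDStH.{u} (n := 2)).toHeyting
  let := hA.toHeyting
  have hbt : (⊥ : A) ≠ ⊤ := bot_ne_top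
  have htb : (⊤ : Cdp.{u} 2) ≠ ⊥ := fun h =>
    absurd (congrArg (fun z : Cdp.{u} 2 => z.down) h) (by decide : (⊤ : Fin 2) ≠ 0)
  have hall : ∀ x : Cdp.{u} 2, x = ⊥ ∨ x = ⊤ := by
    rintro ⟨x⟩
    fin_cases x
    exacts [Or.inl rfl, Or.inr rfl]
  classical
  let g : Cdp.{u} 2 → A := fun x => if x = ⊤ then ⊤ else ⊥
  have htop : g ⊤ = ⊤ := if_pos rfl
  have hbot : g ⊥ = ⊥ := if_neg htb.symm
  have hpt : ￢(⊤ : A) = ⊥ := hA.top_prime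
  have hpb : ￢(⊥ : A) = ⊤ := hA.bot_prime
  have hpt' : ￢(⊤ : Cdp.{u} 2) = ⊥ := Cdp.isJIDL1.top_prime
  have hpb' : ￢(⊥ : Cdp.{u} 2) = ⊤ := Cdp.isJIDL1.bot_prime
  refine V.sub_mem _ A g ⟨fun x y => ?_, fun x y => ?_, fun x y => ?_, fun x => ?_, hbot, htop⟩
    (fun x y hxy => ?_) hV
  · rcases hall x with rfl | rfl <;> rcases hall y with rfl | rfl <;> simp [htop, hbot]
  · rcases hall x with rfl | rfl <;> rcases hall y with rfl | rfl <;> simp [htop, hbot]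
  · rcases hall x with rfl | rfl <;> rcases hall y with rfl | rfl <;> simp [htop, hbot]
  · rcases hall x with rfl | rfl
    · rw [hbot, hpb, hpb', htop]
    · rw [htop, hpt, hpt', hbot]
  · rcases hall x with rfl | rfl <;> rcases hall y with rfl | rfl
    · rfl
    · exact absurd (hbot.symm.trans (hxy.trans htop)) hbt
    · exact absurd (hbot.symm.trans (hxy.symm.trans htop)) hbt
    · rfl

theorem nontrivial_Cdp_two : Nontrivial (Cdp.{u} 2) :=
  ⟨⟨⟨0⟩, ⟨1⟩, fun h => absurd (congrArg (fun z : Cdp.{u} 2 => z.down) h)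
    (by decide : (0 : Fin 2) ≠ 1)⟩⟩

theorem isNontrivial_iff {V : Variety.{u}} (hV : V ≤ JIDL1) :
    V.IsNontrivial ↔ Cdp.{u} 2 ∈ V.carrier :=
  ⟨fun ⟨_, hA, _⟩ => Cdp.two_mem_of_nontrivial (hV hA) hA, fun h => ⟨_, h, nontrivial_Cdp_two⟩⟩

/-- The variety of one-element algebras. -/
def trivialVariety : Variety.{u} where
  carrier := {A | Subsingleton A}
  image_mem _ _ _ _ hs hA := have : Subsingleton _ := hA; hs.subsingleton
  sub_mem _ _ _ _ hi hB := have : Subsingleton _ := hB; hi.subsingleton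
  pi_mem _ _ hA := ⟨fun x y => funext fun i => (hA i).elim (x i) (y i)⟩

theorem not_mem_bot : Cdp.{u} 2 ∉ (⊥ : Variety.{u}).carrier := fun h =>
  not_subsingleton_iff_nontrivial.2 nontrivial_Cdp_two
    ((bot_le : (⊥ : Variety.{u}) ≤ trivialVariety) h)

theorem eq_bot_of_not_mem {V : Variety.{u}} (hV : V ≤ JIDL1) (h : Cdp.{u} 2 ∉ V.carrier) :
    V = ⊥ := by
  refine le_bot_iff.1 fun A hA => ?_
  have : Subsingleton A := not_nontrivial_iff_subsingleton.1 fun _ =>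
    h (Cdp.two_mem_of_nontrivial (hV hA) hA)
  exact mem_of_subsingleton _

theorem eq_stratum {V : Variety.{u}} (hV : V ≤ JIDL1) {k : WithTop ℕ} {d : Fin 2}
    (hC : ∀ j : ℕ, Cdp.{u} (j + 2) ∈ V.carrier ↔ (j : WithTop ℕ) ≤ k)
    (hD : D2.{u} ∈ V.carrier ↔ d = 1) : V = stratum k d :=
  le_antisymm
    (le_of_generators hV (fun h => D2.mem_stratum_iff.2 (hD.1 h))
      fun j h => Cdp.mem_stratum_iff.2 ((hC j).1 h))
    (le_of_generators (stratum_le k d) (fun h => hD.2 (D2.mem_stratum_iff.1 h))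
      fun j h => (hC j).2 (Cdp.mem_stratum_iff.1 h))

theorem exists_eq_stratum {V : Variety.{u}} (hV : V ≤ JIDL1) (h : Cdp.{u} 2 ∈ V.carrier) :
    ∃ k d, V = stratum k d := by
  classical
  obtain ⟨k, hk⟩ : ∃ k : WithTop ℕ, ∀ j : ℕ, Cdp.{u} (j + 2) ∈ V.carrier ↔ (j : WithTop ℕ) ≤ k := by
    by_cases hall : ∀ j : ℕ, Cdp.{u} (j + 2) ∈ V.carrier
    · exact ⟨⊤, fun j => ⟨fun _ => le_top, fun _ => hall j⟩⟩
    · push Not at hall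
      -- The first missing chain is not the two-element one, so its index has a predecessor, which
      -- is the bound `k`.
      obtain ⟨m, hm⟩ : ∃ m, Nat.find hall = m + 1 :=
        Nat.exists_eq_succ_of_ne_zero fun h0 => (h0 ▸ Nat.find_spec hall) h
      refine ⟨m, fun j => ⟨fun hj => ?_, fun hj => ?_⟩⟩
      · by_contra hjm
        have h1 : m + 1 ≤ j := by
          rw [Nat.cast_le, not_le] at hjm
          exact hjm
        exact (hm ▸ Nat.find_spec hall) (Cdp.mem_of_le h1 hj)
      · have h1 : j ≤ m := by exact_mod_cast hj
        exact not_not.1 (Nat.find_min hall (m := j) (by omega))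
  refine ⟨k, if D2.{u} ∈ V.carrier then 1 else 0, eq_stratum hV hk ?_⟩
  split_ifs with hD <;> simp [hD]

/-- Finite chains inside a stratum recover `k`, even when `k = ⊤`, and `D₂` recovers `d`. -/
theorem stratum_le_stratum_iff {k k' : WithTop ℕ} {d d' : Fin 2} :
    stratum.{u} k d ≤ stratum k' d' ↔ k ≤ k' ∧ d ≤ d' := by
  refine ⟨fun h => ⟨?_, ?_⟩, fun h => stratum_mono h.1 h.2⟩
  · exact WithTop.forall_coe_le_iff_le.1 fun j hj =>
      Cdp.mem_stratum_iff.1 (h (Cdp.mem_stratum_iff.2 hj))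
  · by_cases hd : d = 1
    · subst hd
      exact (D2.mem_stratum_iff.1 (h (D2.mem_stratum_iff.2 rfl))).ge
    · have : d = 0 := by omega
      rw [this]
      exact Fin.zero_le _

theorem Cdp_two_mem_stratum (k : WithTop ℕ) (d : Fin 2) : Cdp.{u} 2 ∈ (stratum k d).carrier :=
  Cdp.mem_stratum_iff (j := 0).2 (by simp)

/-- The lattice of subvarieties of `JIDL₁`. -/
theorem exists_subvarietyIso : ∃ e : WithBot (WithTop ℕ × Fin 2) ≃o Set.Iic JIDL1.{u},
    (e ⊥).1 = ⊥ ∧ ∀ (k : WithTop ℕ) (d : Fin 2),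
      (e ((k, d) : WithTop ℕ × Fin 2)).1 = stratum k d := by
  let F : WithBot (WithTop ℕ × Fin 2) → Set.Iic JIDL1.{u} := fun p =>
    p.recBotCoe ⟨⊥, (bot_le : ⊥ ≤ JIDL1)⟩ fun q => ⟨stratum q.1 q.2, stratum_le _ _⟩
  have hF : ∀ p q, F p ≤ F q ↔ p ≤ q := by
    intro p q
    induction p with
    | bot => exact iff_of_true (bot_le (a := (F q).1)) bot_le
    | coe p =>
      induction q with
      | bot =>
        refine iff_of_false (fun h => ?_) (WithBot.not_coe_le_bot _)
        exact not_mem_bot (h (Cdp_two_mem_stratum p.1 p.2))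
      | coe q =>
        rw [WithBot.coe_le_coe]
        exact stratum_le_stratum_iff
  refine ⟨RelIso.ofSurjective (OrderEmbedding.ofMapLEIff F hF) ?_, rfl, fun _ _ => rfl⟩
  rintro ⟨V, hV⟩
  by_cases h : Cdp.{u} 2 ∈ V.carrier
  · obtain ⟨k, d, rfl⟩ := exists_eq_stratum hV h
    exact ⟨((k, d) : WithTop ℕ × Fin 2), rfl⟩
  · exact ⟨⊥, Subtype.ext (eq_bot_of_not_mem hV h).symm⟩

/-! ### Generated varieties as strata. -/

theorem Variety.generate_le {K : Set Alg.{u}} {W : Variety.{u}} (h : K ⊆ W.carrier) :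
    Variety.generate K ≤ W := sInf_le h

theorem Variety.subset_generate (K : Set Alg.{u}) : K ⊆ (Variety.generate K).carrier :=
  fun _ hA _ hV => hV hA

theorem JIDL1_eq_stratum : JIDL1.{u} = stratum ⊤ 1 := by
  refine le_antisymm (fun A hA => ⟨hA, fun m hm => ?_, fun h => absurd h (by decide)⟩)
    (stratum_le _ _)
  exact absurd (top_le_iff.1 hm) (WithTop.coe_ne_top (a := m))

theorem DStHC_eq_stratum : DStHC.{u} = stratum ⊤ 0 := by
  refine le_antisymm (Variety.generate_le ?_) (le_of_generators (stratum_le _ _) ?_ ?_)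
  · rintro A ⟨h1, h2⟩
    exact ⟨h1.isJIDL1 h2, fun m hm => absurd (top_le_iff.1 hm) (WithTop.coe_ne_top (a := m)),
      fun _ => h1.dualStone⟩
  · exact fun h => absurd (D2.mem_stratum_iff.1 h) (by decide)
  · exact fun j _ => Variety.subset_generate _ ⟨Cdp.isDStH, Cdp.isChainAlg⟩

theorem Cdp.generate_eq_stratum (j : ℕ) [NeZero (j + 2)] :
    Variety.generate {Cdp.{u} (j + 2)} = stratum j 0 := by
  refine le_antisymm (Variety.generate_le ?_) (le_of_generators (stratum_le _ _) ?_ ?_)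
  · rintro A rfl
    exact Cdp.mem_stratum_iff.2 le_rfl
  · exact fun h => absurd (D2.mem_stratum_iff.1 h) (by decide)
  · intro i hi
    exact Cdp.mem_of_le (Nat.cast_le.1 (Cdp.mem_stratum_iff.1 hi)) (Variety.subset_generate _ rfl)

theorem stratum_le_of_mem {k : ℕ} {V : Variety.{u}} (hC : Cdp.{u} (k + 2) ∈ V.carrier)
    (hD : D2.{u} ∈ V.carrier) : stratum k 1 ≤ V :=
  le_of_generators (stratum_le _ _) (fun _ => hD)
    fun _ hi => Cdp.mem_of_le (Nat.cast_le.1 (Cdp.mem_stratum_iff.1 hi)) hC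

/-- Since `D₂` contains the two-element chain, it generates the whole stratum at `k = 0`, which is
also the join with `V(C₂ᵈᵖ)`. -/
theorem D2.generate_eq_stratum : Variety.generate {D2.{u}} = stratum 0 1 := by
  have hD : D2.{u} ∈ (Variety.generate {D2.{u}}).carrier := Variety.subset_generate _ rfl
  have : Nontrivial D2.{u} := ⟨⟨⟨⊥⟩, ⟨⊤⟩, fun h =>
    absurd (congrArg (fun z : D2.{u} => z.down) h) (by decide : (⊥ : Bool × Bool) ≠ ⊤)⟩⟩
  refine le_antisymm (Variety.generate_le ?_)
    (stratum_le_of_mem (k := 0) (Cdp.two_mem_of_nontrivial D2.isJIDL1 hD) hD)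
  rintro A rfl
  exact D2.mem_stratum_iff.2 rfl

theorem Cdp.generate_sup_eq_stratum (j : ℕ) [NeZero (j + 2)] :
    Variety.generate {Cdp.{u} (j + 2)} ⊔ Variety.generate {D2.{u}} = stratum j 1 := by
  refine le_antisymm (sup_le ?_ ?_) (stratum_le_of_mem ?_ ?_)
  · rw [Cdp.generate_eq_stratum]
    exact stratum_mono le_rfl (by decide)
  · rw [D2.generate_eq_stratum]
    exact stratum_mono (by simp) le_rfl
  · exact (le_sup_left : Variety.generate {Cdp.{u} (j + 2)} ≤ _) (Variety.subset_generate _ rfl)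
  · exact (le_sup_right : Variety.generate {D2.{u}} ≤ _) (Variety.subset_generate _ rfl)

/-! ### Finite and infinite heights. -/

theorem height_natCast_lt_top (n : ℕ) (d : Fin 2) :
    Order.height (((n : WithTop ℕ), d) : WithBot (WithTop ℕ × Fin 2)) < ⊤ := by
  -- The sum `n + d + 1` is a strictly increasing rank; the `1` accounts for the adjoined bottom.
  have key : ∀ N n : ℕ, ∀ d : Fin 2, n + d.val + 1 ≤ N →
      Order.height (((n : WithTop ℕ), d) : WithBot (WithTop ℕ × Fin 2)) ≤ N := by
    intro N
    induction N with
    | zero => intro n d h; omega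
    | succ N ih =>
      intro n d h
      rw [Order.height_le_coe_iff]
      intro y hy
      induction y with
      | bot => rw [Order.height_bot]; exact_mod_cast Nat.succ_pos N
      | coe y =>
        obtain ⟨k, e⟩ := y
        rw [WithBot.coe_lt_coe, Prod.mk_lt_mk] at hy
        have hk : k ≤ n := hy.elim (fun h => h.1.le) fun h => h.1
        obtain ⟨m, rfl⟩ := WithTop.ne_top_iff_exists.1 (ne_top_of_le_ne_top WithTop.coe_ne_top hk)
        have hlt : m + e.val < n + d.val := by
          rcases hy with ⟨h1, h2⟩ | ⟨h1, h2⟩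
          · exact add_lt_add_of_lt_of_le (WithTop.coe_lt_coe.1 h1) h2
          · exact add_lt_add_of_le_of_lt (WithTop.coe_le_coe.1 h1) h2
        refine lt_of_le_of_lt (ih m e (by omega)) ?_
        exact_mod_cast Nat.lt_succ_self N
  exact lt_of_le_of_lt (key _ n d le_rfl) (ENat.natCast_lt_top _)

/-- The increasing sequence of all `(n, 0)` lies below `(⊤, d)`. -/
theorem height_top (d : Fin 2) :
    Order.height (((⊤ : WithTop ℕ), d) : WithBot (WithTop ℕ × Fin 2)) = ⊤ := by
  refine ENat.eq_top_iff_forall_ge.2 fun n => ?_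
  have key : ∀ n : ℕ, (n : ℕ∞) ≤
      Order.height (((n : WithTop ℕ), (0 : Fin 2)) : WithBot (WithTop ℕ × Fin 2)) := by
    intro n
    induction n with
    | zero => exact bot_le
    | succ n ih =>
      refine le_trans ?_ (Order.height_add_one_le
        (a := (((n : WithTop ℕ), (0 : Fin 2)) : WithBot (WithTop ℕ × Fin 2))) ?_)
      · push_cast
        gcongr
      · rw [WithBot.coe_lt_coe, Prod.mk_lt_mk]
        exact Or.inl ⟨WithTop.coe_lt_coe.2 n.lt_succ_self, le_rfl⟩
  refine (key n).trans (Order.height_mono ?_)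
  rw [WithBot.coe_le_coe]
  exact ⟨le_top, Fin.zero_le _⟩

end SemiHeyting

open SemiHeyting in
theorem corollary7p1 :
    Nonempty (Set.Iic JIDL1.{u} ≃o WithBot (WithTop ℕ × Fin 2)) ∧
    (DStHC.{u} ≠ JIDL1.{u} ∧
      ∀ V : Variety.{u},
        (∃ h : V ≤ JIDL1, Order.height (⟨V, h⟩ : Set.Iic JIDL1.{u}) = ⊤) ↔
          V = JIDL1 ∨ V = DStHC) ∧
    ∀ V : Variety.{u},
      (∃ h : V ≤ JIDL1, V.IsNontrivial ∧ Order.height (⟨V, h⟩ : Set.Iic JIDL1.{u}) < ⊤) ↔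
        V = Variety.generate {D2} ∨
        (∃ (n : ℕ) (_ : NeZero n), n ≠ 1 ∧ V = Variety.generate {Cdp n}) ∨
        (∃ (m : ℕ) (_ : NeZero m), m ≠ 1 ∧
          V = Variety.generate {Cdp m} ⊔ Variety.generate {D2}) := by
  obtain ⟨e, he, he'⟩ := exists_subvarietyIso.{u}
  have hheight : ∀ (k : WithTop ℕ) (d : Fin 2) (h : stratum.{u} k d ≤ JIDL1),
      Order.height (⟨stratum k d, h⟩ : Set.Iic JIDL1.{u}) =
        Order.height ((k, d) : WithBot (WithTop ℕ × Fin 2)) := by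
    intro k d h
    rw [← Order.height_orderIso e]
    exact congrArg Order.height (Subtype.ext (he' k d).symm)
  have hcases : ∀ V : Variety.{u}, V ≤ JIDL1 → V = ⊥ ∨ ∃ k d, V = stratum k d := by
    intro V hV
    by_cases h : Cdp.{u} 2 ∈ V.carrier
    exacts [Or.inr (exists_eq_stratum hV h), Or.inl (eq_bot_of_not_mem hV h)]
  have hfin2 : ∀ d : Fin 2, d = 0 ∨ d = 1 := by decide
  have hfinite : ∀ (j : ℕ) (d : Fin 2), ∃ h : stratum.{u} j d ≤ JIDL1,
      (stratum.{u} j d).IsNontrivial ∧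
        Order.height (⟨stratum j d, h⟩ : Set.Iic JIDL1.{u}) < ⊤ := fun j d =>
    ⟨stratum_le _ _, (isNontrivial_iff (stratum_le _ _)).2 (Cdp_two_mem_stratum _ _), by
      rw [hheight]; exact height_natCast_lt_top j d⟩
  have hsize : ∀ n : ℕ, NeZero n → n ≠ 1 → ∃ j, n = j + 2 := fun n h0 h1 => by
    have := h0.ne
    exact ⟨n - 2, by omega⟩
  refine ⟨⟨e.symm⟩, ⟨?_, fun V => ⟨?_, ?_⟩⟩, fun V => ⟨?_, ?_⟩⟩
  · rw [DStHC_eq_stratum, JIDL1_eq_stratum]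
    intro h
    exact absurd (stratum_le_stratum_iff.1 h.ge).2 (by decide)
  · rintro ⟨hV, hh⟩
    rcases hcases V hV with rfl | ⟨k, d, rfl⟩
    · have h1 : (⟨⊥, hV⟩ : Set.Iic JIDL1.{u}) = e ⊥ := Subtype.ext he.symm
      rw [h1, Order.height_orderIso, Order.height_bot] at hh
      exact absurd hh (by simp)
    · rw [hheight] at hh
      induction k with
      | coe j => exact absurd hh (height_natCast_lt_top j d).ne
      | top =>
        rcases hfin2 d with rfl | rfl
        exacts [Or.inr DStHC_eq_stratum.symm, Or.inl JIDL1_eq_stratum.symm]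
  · rintro (h | h)
    · obtain rfl : V = stratum ⊤ 1 := h.trans JIDL1_eq_stratum
      exact ⟨stratum_le _ _, by rw [hheight, height_top]⟩
    · obtain rfl : V = stratum ⊤ 0 := h.trans DStHC_eq_stratum
      exact ⟨stratum_le _ _, by rw [hheight, height_top]⟩
  · rintro ⟨hV, hn, hh⟩
    rcases hcases V hV with rfl | ⟨k, d, rfl⟩
    · exact absurd ((isNontrivial_iff hV).1 hn) not_mem_bot
    · rw [hheight] at hh
      induction k with
      | top => exact absurd (height_top d) hh.ne
      | coe j =>
        right
        rcases hfin2 d with rfl | rfl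
        · exact Or.inl ⟨j + 2, inferInstance, by omega, (Cdp.generate_eq_stratum j).symm⟩
        · exact Or.inr ⟨j + 2, inferInstance, by omega, (Cdp.generate_sup_eq_stratum j).symm⟩
  · rintro (h | ⟨n, h0, h1, h⟩ | ⟨n, h0, h1, h⟩)
    · obtain rfl := h.trans D2.generate_eq_stratum
      exact hfinite 0 1
    · obtain ⟨j, rfl⟩ := hsize n h0 h1
      obtain rfl := h.trans (Cdp.generate_eq_stratum j)
      exact hfinite j 0
    · obtain ⟨j, rfl⟩ := hsize n h0 h1
      obtain rfl := h.trans (Cdp.generate_sup_eq_stratum j)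
      exact hfinite j 1
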